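/- For graphs $G$ (finite) and $H$, a spanning subgraph $F\subseteq G$ is weakly $(G,H)$-saturated if there is a (possibly empty) sequence of graphs $F=F_0\subset F_1\subset\dots\subset F_m=G$ such that each $F_i$ is obtained from $F_{i-1}$ by adding one edge that belongs to a copy of $H$ in $F_i$; $\mathrm{wsat}(G,H)$ is the smallest number of edges in a weakly $(G,H)$-saturated graph. Let $G(n,p)$ be the binomial random graph on $n$ labelled vertices, in which each pair of vertices is adjacent with probability $p$ independently of the others; "whp" means with probability tending to $1$ as $n\to\infty$. Let $t\ge 3$ be an integer and $p(n,t)=n^{-\frac1{t-1}}(\ln n)^{-\frac{t-2}{t-1}}$. Then $\mathrm{wsat}(K_n,K_{1,t})=\binom t2$ for all $n\ge t$, and the following hold. (1) There exists $c>0$, depending only on $t$, such that, for every sequence $p=p_n\in[0,1]$, if $\frac1{n^2}=o(p)$ and $p<c\,p(n,t)$ for all sufficiently large $n$, then whp $\mathrm{wsat}(G(n,p),K_{1,t})\ne\mathrm{wsat}(K_n,K_{1,t})$. (2) There exists $C>0$, depending only on $t$, such that, for every sequence $p=p_n\in[0,1]$, if $p>C\,p(n,t)$ for all sufficiently large $n$,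 then whp $\mathrm{wsat}(G(n,p),K_{1,t})=\mathrm{wsat}(K_n,K_{1,t})$. -/

import Mathlib

open Filter Topology Asymptotics

/-- `B` is obtained from `A` by adding one new edge, and this edge belongs to a copy of `H`
in `B` (a not necessarily induced subgraph of `B` isomorphic to `H`). -/
def BootstrapStep {V W : Type*} (H : SimpleGraph W) (A B : SimpleGraph V) : Prop :=
  ∃ e : Sym2 V, e ∉ A.edgeSet ∧ B.edgeSet = insert e A.edgeSet ∧
    ∃ φ : SimpleGraph.Copy H B, e ∈ Sym2.map φ '' H.edgeSet

/-- The spanning subgraph `F` of `G` is weakly `(G, H)`-saturated: some `H`-bootstrap percolation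
process (a finite, possibly empty, sequence of steps) starts at `F` and finishes at `G`. -/
def IsWeaklySaturated {V W : Type*} (G : SimpleGraph V) (H : SimpleGraph W)
    (F : SimpleGraph V) : Prop :=
  F ≤ G ∧ Relation.ReflTransGen (BootstrapStep H) F G

/-- The weak saturation number: the smallest number of edges in a weakly `(G, H)`-saturated graph.
The set is nonempty, since it contains the number of edges of `G`. -/
noncomputable def wsat {V W : Type*} [Finite V] (G : SimpleGraph V) (H : SimpleGraph W) : ℕ :=
  sInf {m : ℕ | ∃ F : SimpleGraph V, IsWeaklySaturated G H F ∧ F.edgeSet.ncard = m}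

/-- The star `K_{1,t}`. -/
abbrev starGraphK (t : ℕ) : SimpleGraph (Fin 1 ⊕ Fin t) :=
  completeBipartiteGraph (Fin 1) (Fin t)

/-- `p(n, t) = n ^ (-1/(t-1)) * (ln n) ^ (-(t-2)/(t-1))`. -/
noncomputable def thresholdProb (n t : ℕ) : ℝ :=
  (n : ℝ) ^ (-(1 / ((t : ℝ) - 1))) * (Real.log n) ^ (-(((t : ℝ) - 2) / ((t : ℝ) - 1)))

/-- The binomial random graph `G(n, p n)` has the property `P n` with high probability: the
probability tends to `1` as `n → ∞`. -/
def Whp (p : ℕ → unitInterval) (P : (n : ℕ) → SimpleGraph (Fin n) → Prop) : Prop :=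
  Tendsto (fun n : ℕ => SimpleGraph.binomialRandom (Fin n) (p n) {G | P n G}) atTop (𝓝 1)

/-! Put r = t - 1. An edge can be added exactly when one of its ends already has degree at least r,
and then all edges of G at that end can be added. So the process is r-neighbour bootstrap
percolation of active vertices, recorded by `Activation`. When i vertices are already active, the
next one needs at least r - i edges of F to vertices not yet active; these numbers sum to
binom(t,2). If fewer than r vertices ever become active, every edge of G avoiding them lies in F, so
`choose_two_le_wsat_star` only asks that G have enough such edges. Conversely, a percolating
r-clique with one outward edge at each vertex costs binom(r,2) + r = binom(t,2) edges
(`wsat_star_le_choose_two`).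

Write u = log n. Above the threshold, a nucleus is grown vertex by vertex to size about u^2: the
first r vertices form a clique, and each later one has r neighbours among its predecessors. The
bottleneck is at sizes up to l, about x u for a small constant x. One attempt succeeds with
probability at least exp(-(2r+5) l), roughly n^(-1/4), and about n^(1/2) nearly disjoint attempts
are available (`bprob_not_built_le`, `layer_bound`, `le_prod_layerProb`). By a union bound every set
of size at least u^2 has an outside vertex with r neighbours in it
(`bprob_not_expanding_le_of_pow_eq`), so the nucleus percolates. Both properties are increasing, so
it suffices to treat p equal to C times the threshold.

Below the threshold, suppose the weak saturation number is c = binom(t,2). Either about u vertices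
become active, and the first m of them span at least r m - c edges, which a first moment bound
excludes (`dense_bound`); or the activation stops earlier, and O(u) vertices cover all edges, which
is unlikely unless p is tiny (`cover_bound`). For p at most n^(-7/4), whp no two edges share a
vertex, so nothing can be added and the number is the edge count, which whp exceeds c because p n^2
tends to infinity. -/

section BernoulliSums

/-! ### Random subsets of a finite set: expectation, independence, Chernoff bounds. -/

variable {α : Type*}

/-- The expectation of `f` at the random subset of `s` that contains every element independently
with probability `p`. -/
noncomputable def bexp (s : Finset α) (p : ℝ) (f : Finset α → ℝ) : ℝ :=
  ∑ ω ∈ s.powerset, p ^ ω.card * (1 - p) ^ (s.card - ω.card) * f ω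

open Classical in
/-- The probability that the random `p`-subset of `s` satisfies `P`. -/
noncomputable def bprob (s : Finset α) (p : ℝ) (P : Finset α → Prop) : ℝ :=
  bexp s p (fun ω => if P ω then 1 else 0)

theorem bexp_empty (p : ℝ) (f : Finset α → ℝ) : bexp ∅ p f = f ∅ := by simp [bexp]

theorem bexp_congr {s : Finset α} {p : ℝ} {f g : Finset α → ℝ} (h : ∀ ω ⊆ s, f ω = g ω) :
    bexp s p f = bexp s p g :=
  Finset.sum_congr rfl fun ω hω => by rw [h ω (Finset.mem_powerset.1 hω)]

theorem bexp_mono {s : Finset α} {p : ℝ} (h0 : 0 ≤ p) (h1 : p ≤ 1) {f g : Finset α → ℝ}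
    (h : ∀ ω ⊆ s, f ω ≤ g ω) : bexp s p f ≤ bexp s p g :=
  Finset.sum_le_sum fun ω hω => mul_le_mul_of_nonneg_left (h ω (Finset.mem_powerset.1 hω))
    (mul_nonneg (pow_nonneg h0 _) (pow_nonneg (sub_nonneg.2 h1) _))

theorem bexp_add (s : Finset α) (p : ℝ) (f g : Finset α → ℝ) :
    bexp s p (fun ω => f ω + g ω) = bexp s p f + bexp s p g := by
  simp [bexp, mul_add, Finset.sum_add_distrib]

theorem bexp_const_mul (s : Finset α) (p c : ℝ) (f : Finset α → ℝ) :
    bexp s p (fun ω => c * f ω) = c * bexp s p f := by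
  simp only [bexp, Finset.mul_sum]
  exact Finset.sum_congr rfl fun _ _ => by ring

theorem bexp_sum {ι : Type*} (s : Finset α) (p : ℝ) (t : Finset ι) (f : ι → Finset α → ℝ) :
    bexp s p (fun ω => ∑ i ∈ t, f i ω) = ∑ i ∈ t, bexp s p (f i) := by
  simp only [bexp, Finset.mul_sum]
  exact Finset.sum_comm

/-- The binomial generating function: z = 1 gives total mass one, other values of z give the
Chernoff bounds. -/
theorem bexp_pow_card (s : Finset α) (p z : ℝ) :
    bexp s p (fun ω => z ^ ω.card) = (1 - p + p * z) ^ s.card := by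
  rw [add_comm, ← Finset.sum_pow_mul_eq_add_pow]
  exact Finset.sum_congr rfl fun _ _ => by ring

theorem bexp_const (s : Finset α) (p c : ℝ) : bexp s p (fun _ => c) = c := by
  have := bexp_pow_card s p 1
  have h := bexp_const_mul s p c (fun _ => 1)
  simp only [one_pow, mul_one, sub_add_cancel] at this h
  rw [h, this, mul_one]

theorem bprob_mono {s : Finset α} {p : ℝ} (h0 : 0 ≤ p) (h1 : p ≤ 1) {P Q : Finset α → Prop}
    (h : ∀ ω ⊆ s, P ω → Q ω) : bprob s p P ≤ bprob s p Q := by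
  refine bexp_mono h0 h1 fun ω hω => ?_
  by_cases hP : P ω
  · simp [hP, h ω hω hP]
  · simp only [hP, if_false]; split_ifs <;> norm_num

theorem bprob_nonneg {s : Finset α} {p : ℝ} (h0 : 0 ≤ p) (h1 : p ≤ 1) (P : Finset α → Prop) :
    0 ≤ bprob s p P := by
  rw [← bexp_const s p 0]
  exact bexp_mono h0 h1 fun ω _ => by split_ifs <;> norm_num

theorem bprob_le_one {s : Finset α} {p : ℝ} (h0 : 0 ≤ p) (h1 : p ≤ 1) (P : Finset α → Prop) :
    bprob s p P ≤ 1 := by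
  conv_rhs => rw [← bexp_const s p 1]
  exact bexp_mono h0 h1 fun ω _ => by split_ifs <;> norm_num

theorem bprob_not (s : Finset α) (p : ℝ) (P : Finset α → Prop) :
    bprob s p (fun ω => ¬ P ω) = 1 - bprob s p P := by
  rw [eq_sub_iff_add_eq, bprob, bprob, ← bexp_add]
  refine Eq.trans ?_ (bexp_const s p 1)
  exact bexp_congr fun ω _ => by by_cases h : P ω <;> simp [h]

theorem bprob_exists_le {ι : Type*} {s : Finset α} {p : ℝ} (h0 : 0 ≤ p) (h1 : p ≤ 1)
    (t : Finset ι) (P : ι → Finset α → Prop) :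
    bprob s p (fun ω => ∃ i ∈ t, P i ω) ≤ ∑ i ∈ t, bprob s p (P i) := by
  unfold bprob
  rw [← bexp_sum]
  refine bexp_mono h0 h1 fun ω _ => ?_
  split_ifs with h
  · obtain ⟨i, hi, hP⟩ := h
    refine le_trans ?_ (Finset.single_le_sum (fun j _ => ?_) hi)
    · simp [hP]
    · split_ifs <;> norm_num
  · exact Finset.sum_nonneg fun j _ => by split_ifs <;> norm_num

theorem bprob_or_le {s : Finset α} {p : ℝ} (h0 : 0 ≤ p) (h1 : p ≤ 1) (P Q : Finset α → Prop) :
    bprob s p (fun ω => P ω ∨ Q ω) ≤ bprob s p P + bprob s p Q := by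
  unfold bprob
  rw [← bexp_add]
  refine bexp_mono h0 h1 fun ω _ => ?_
  by_cases h : P ω <;> by_cases h' : Q ω <;> simp [h, h']

/-- The probability that the random set has at least `j` elements is at least the probability that
it has exactly `j` elements. -/
theorem le_bprob_card {s : Finset α} {p : ℝ} (h0 : 0 ≤ p) (h1 : p ≤ 1) (j : ℕ) :
    (s.card.choose j : ℝ) * (p ^ j * (1 - p) ^ (s.card - j)) ≤ bprob s p (fun ω => j ≤ ω.card) := by
  classical
  have h : (s.card.choose j : ℝ) * (p ^ j * (1 - p) ^ (s.card - j))
      = bexp s p (fun ω => if ω.card = j then 1 else 0) := by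
    simp only [bexp, mul_ite, mul_one, mul_zero]
    rw [← Finset.sum_filter, ← Finset.powersetCard_eq_filter,
      Finset.sum_congr rfl fun ω hω => by rw [(Finset.mem_powersetCard.1 hω).2],
      Finset.sum_const, Finset.card_powersetCard, nsmul_eq_mul]
  rw [h]
  refine bexp_mono h0 h1 fun ω _ => ?_
  split_ifs with h2 h3 <;> first | exact absurd h2.ge h3 | norm_num

variable [DecidableEq α]

theorem bexp_insert {s : Finset α} {a : α} (ha : a ∉ s) (p : ℝ) (f : Finset α → ℝ) :
    bexp (insert a s) p f
      = bexp s p (fun ω => (1 - p) * f ω + p * f (insert a ω)) := by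
  unfold bexp
  rw [Finset.sum_powerset_insert ha, ← Finset.sum_add_distrib]
  refine Finset.sum_congr rfl fun ω hω => ?_
  have hs := Finset.mem_powerset.1 hω
  have hc := Finset.card_le_card hs
  rw [Finset.card_insert_of_notMem ha, Finset.card_insert_of_notMem (fun h => ha (hs h)),
    Nat.add_sub_add_right, Nat.sub_add_comm hc]
  ring

/-- Fubini's theorem: a random subset of a disjoint union can be exposed in two rounds. -/
theorem bexp_union {s t : Finset α} (h : Disjoint s t) (p : ℝ) (f : Finset α → ℝ) :
    bexp (s ∪ t) p f = bexp s p (fun a => bexp t p (fun b => f (a ∪ b))) := by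
  induction s using Finset.induction_on generalizing f with
  | empty => simp [bexp_empty]
  | insert a s ha ih =>
    rw [Finset.disjoint_insert_left] at h
    rw [Finset.insert_union, bexp_insert (by simp [ha, h.1]), bexp_insert ha, ih h.2]
    refine bexp_congr fun ω _ => ?_
    rw [bexp_add, bexp_const_mul, bexp_const_mul]
    simp [Finset.insert_union]

/-- Elements outside `s` average out by Fubini, so an event may be studied on the part of the ground
set that it depends on. -/
theorem bexp_inter {s S : Finset α} (h : s ⊆ S) (p : ℝ) (f : Finset α → ℝ) :
    bexp S p (fun ω => f (ω ∩ s)) = bexp s p f := by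
  conv_lhs => rw [← Finset.union_sdiff_of_subset h]
  rw [bexp_union Finset.disjoint_sdiff]
  refine bexp_congr fun a ha => ?_
  rw [← bexp_const (S \ s) p (f a)]
  refine bexp_congr fun b hb => ?_
  congr 1
  ext x
  have h1 := @ha x
  have h2 := @hb x
  simp only [Finset.mem_sdiff, Finset.mem_inter, Finset.mem_union] at *
  tauto

/-- The probability of an increasing event is an increasing function of `p`. -/
theorem bexp_mono_param {s : Finset α} {p q : ℝ} (h0 : 0 ≤ p) (hpq : p ≤ q) (h1 : q ≤ 1)
    {f : Finset α → ℝ} (hf : Monotone f) : bexp s p f ≤ bexp s q f := by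
  induction s using Finset.induction_on generalizing f with
  | empty => simp [bexp_empty]
  | insert a s ha ih =>
    rw [bexp_insert ha, bexp_insert ha]
    have hm : Monotone (fun ω => f (insert a ω)) := fun x y hxy =>
      hf (Finset.insert_subset_insert a hxy)
    refine le_trans (ih fun x y hxy => ?_) (bexp_mono (h0.trans hpq) h1 fun ω _ => ?_)
    · exact add_le_add (mul_le_mul_of_nonneg_left (hf hxy) (by linarith))
        (mul_le_mul_of_nonneg_left (hm hxy) h0)
    · have := hf (Finset.subset_insert a ω)
      nlinarith

theorem bprob_mono_param {s : Finset α} {p q : ℝ} (h0 : 0 ≤ p) (hpq : p ≤ q) (h1 : q ≤ 1)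
    {P : Finset α → Prop} (hP : ∀ a b, a ⊆ b → P a → P b) : bprob s p P ≤ bprob s q P := by
  refine bexp_mono_param h0 hpq h1 fun a b hab => ?_
  by_cases h : P a
  · simp [h, hP a b hab h]
  · simp only [h, if_false]; split_ifs <;> norm_num

theorem bprob_subset {s T : Finset α} (h : T ⊆ s) (p : ℝ) :
    bprob s p (fun ω => T ⊆ ω) = p ^ T.card := by
  classical
  have : bprob s p (fun ω => T ⊆ ω) = bexp s p (fun ω => if ω ∩ T = T then 1 else 0) :=
    bexp_congr fun ω _ => by simp [Finset.inter_eq_right]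
  rw [this, bexp_inter h p (fun ω => if ω = T then 1 else 0)]
  simp [bexp]

theorem bprob_disjoint {s T : Finset α} (h : T ⊆ s) (p : ℝ) :
    bprob s p (fun ω => Disjoint ω T) = (1 - p) ^ T.card := by
  classical
  have : bprob s p (fun ω => Disjoint ω T) = bexp s p (fun ω => if ω ∩ T = ∅ then 1 else 0) :=
    bexp_congr fun ω _ => by simp [Finset.disjoint_iff_inter_eq_empty]
  rw [this, bexp_inter h p (fun ω => if ω = ∅ then 1 else 0)]
  simp [bexp]

/-- Chernoff bound for the upper tail. -/
theorem bprob_card_ge_le {s T : Finset α} (h : T ⊆ s) {p : ℝ} (h0 : 0 ≤ p) (h1 : p ≤ 1) {z : ℝ}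
    (hz : 1 ≤ z) (j : ℕ) :
    bprob s p (fun ω => j ≤ (ω ∩ T).card) ≤ (1 - p + p * z) ^ T.card / z ^ j := by
  rw [← bexp_pow_card, ← bexp_inter h, div_eq_inv_mul, ← bexp_const_mul]
  refine bexp_mono h0 h1 fun ω _ => ?_
  have hz0 : 0 < z ^ j := by positivity
  split_ifs with hj
  · rw [← div_eq_inv_mul, le_div_iff₀ hz0, one_mul]
    exact pow_le_pow_right₀ hz hj
  · positivity

/-- Chernoff bound for the lower tail. -/
theorem bprob_card_le_le {s T : Finset α} (h : T ⊆ s) {p : ℝ} (h0 : 0 ≤ p) (h1 : p ≤ 1) (j : ℕ) :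
    bprob s p (fun ω => (ω ∩ T).card ≤ j) ≤ 2 ^ j * (1 - p / 2) ^ T.card := by
  have := bexp_pow_card T p (1 / 2)
  rw [show 1 - p + p * (1 / 2) = 1 - p / 2 by ring] at this
  rw [← this, ← bexp_inter h, ← bexp_const_mul]
  refine bexp_mono h0 h1 fun ω _ => ?_
  split_ifs with hj
  · rw [one_div, inv_pow, ← div_eq_mul_inv, le_div_iff₀ (by positivity), one_mul]
    exact pow_le_pow_right₀ (by norm_num) hj
  · positivity

end BernoulliSums

/-! ### The binomial random graph as a random set of pairs. -/

section RandomGraph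

variable (V : Type*) [Fintype V] [DecidableEq V]

/-- The set of all pairs of distinct vertices. -/
def allEdges : Finset (Sym2 V) := Finset.univ.filter fun e => ¬ e.IsDiag

variable {V}

theorem mem_allEdges {u v : V} : s(u, v) ∈ allEdges V ↔ u ≠ v := by simp [allEdges]

theorem card_allEdges : (allEdges V).card = (Fintype.card V).choose 2 := by
  rw [← Sym2.card_diagSet_compl, Fintype.card_subtype]
  congr 1

/-- The graph with a given set of edges. -/
abbrev edgeGraph (ω : Finset (Sym2 V)) : SimpleGraph V := SimpleGraph.fromEdgeSet (ω : Set (Sym2 V))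

theorem edgeSet_edgeGraph {ω : Finset (Sym2 V)} (h : ω ⊆ allEdges V) :
    (edgeGraph ω).edgeSet = ω := by
  rw [SimpleGraph.edgeSet_fromEdgeSet]
  ext e
  simp only [Set.mem_sdiff, Finset.mem_coe]
  refine ⟨fun h => h.1, fun he => ⟨he, ?_⟩⟩
  simpa [allEdges] using h he

/-- The bridge from measure theory to finite sums; all later probability estimates are about
`bprob`. -/
theorem binomialRandom_eq_bprob (p : unitInterval) (P : SimpleGraph V → Prop) :
    SimpleGraph.binomialRandom V p {G | P G}
      = ENNReal.ofReal (bprob (allEdges V) p fun ω => P (edgeGraph ω)) := by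
  classical
  have hp0 : (0 : ℝ) ≤ p := p.2.1
  have hp1 : (p : ℝ) ≤ 1 := p.2.2
  have : MeasurableSingletonClass (SimpleGraph V) := ⟨fun G => by
    rw [← SimpleGraph.measurableEmbedding_edgeSet.measurableSet_image, Set.image_singleton]
    exact measurableSet_singleton _⟩
  have hfin : {G : SimpleGraph V | P G}
      = ↑((Finset.univ : Finset (SimpleGraph V)).filter P) := by ext; simp
  rw [hfin, ← MeasureTheory.sum_measure_singleton, bprob, bexp, ENNReal.ofReal_sum_of_nonneg]
  · simp only [mul_ite, mul_one, mul_zero]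
    rw [Finset.sum_filter]
    symm
    refine Finset.sum_bij' (fun ω _ => edgeGraph ω) (fun G _ => G.edgeFinset) ?_ ?_ ?_ ?_ ?_
    · simp
    · intro G _
      refine Finset.mem_powerset.2 fun e he => ?_
      simp only [allEdges, Finset.mem_filter, Finset.mem_univ, true_and]
      exact G.not_isDiag_of_mem_edgeFinset he
    · intro ω hω
      ext e
      simp only [SimpleGraph.mem_edgeFinset]
      rw [edgeSet_edgeGraph (Finset.mem_powerset.1 hω), Finset.mem_coe]
    · intro G _
      simp [edgeGraph]
    · intro ω hω
      have hs := Finset.mem_powerset.1 hω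
      split_ifs with h
      · rw [SimpleGraph.binomialRandom_singleton, edgeSet_edgeGraph hs, Set.ncard_coe_finset,
          Nat.card_eq_fintype_card, card_allEdges, ENNReal.ofReal_mul (by positivity),
          ENNReal.ofReal_pow hp0, ENNReal.ofReal_pow (by linarith)]
        congr 2
        · exact ENNReal.ofReal_coe_nnreal (p := unitInterval.toNNReal p)
        · exact ENNReal.ofReal_coe_nnreal (p := unitInterval.toNNReal (unitInterval.symm p))
      · simp
  · intro ω _
    have : (0 : ℝ) ≤ 1 - p := by linarith
    split_ifs <;> positivity

end RandomGraph

theorem whp_of_bprob_not_le {p : ℕ → unitInterval} {P : (n : ℕ) → SimpleGraph (Fin n) → Prop}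
    {ε : ℕ → ℝ} (hε : Tendsto ε atTop (𝓝 0))
    (h : ∀ᶠ n in atTop,
      bprob (allEdges (Fin n)) (p n) (fun ω => ¬ P n (edgeGraph ω)) ≤ ε n) : Whp p P := by
  unfold Whp
  simp only [binomialRandom_eq_bprob]
  rw [← ENNReal.ofReal_one]
  refine ENNReal.tendsto_ofReal ?_
  have h1 : Tendsto (fun n => 1 - ε n) atTop (𝓝 1) := by simpa using hε.const_sub 1
  refine tendsto_of_tendsto_of_tendsto_of_le_of_le' h1 tendsto_const_nhds ?_ ?_
  · filter_upwards [h] with n hn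
    rw [bprob_not] at hn
    linarith
  · exact Eventually.of_forall fun n => bprob_le_one (p n).2.1 (p n).2.2 _

/-! ### Star saturation as bootstrap percolation, and the deterministic bounds. -/

section StarPercolation

variable {V : Type*}

/-- The vertex `v` has at least `r` neighbours in `Z`. -/
def ManyNbrs (G : SimpleGraph V) (r : ℕ) (v : V) (Z : Set V) : Prop :=
  ∃ T : Finset V, r ≤ T.card ∧ ∀ u ∈ T, G.Adj v u ∧ u ∈ Z

theorem ManyNbrs.mono {G H : SimpleGraph V} {r : ℕ} {v : V} {Z Y : Set V} (h : ManyNbrs G r v Z)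
    (hG : G ≤ H) (hZ : Z ⊆ Y) : ManyNbrs H r v Y :=
  let ⟨T, hT, h⟩ := h
  ⟨T, hT, fun u hu => ⟨hG (h u hu).1, hZ (h u hu).2⟩⟩

/-- A set is closed under `r`-neighbour bootstrap percolation. -/
def PercClosed (G : SimpleGraph V) (r : ℕ) (Z : Set V) : Prop :=
  ∀ v, ManyNbrs G r v Z → v ∈ Z

/-- Every edge of a star contains the centre, so the other t - 1 edges of the copy are present
before the step and give the centre its degree. -/
theorem BootstrapStep.star_adj {t : ℕ} {A B : SimpleGraph V}
    (h : BootstrapStep (starGraphK t) A B) :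
    ∃ v w, (∀ x y, B.Adj x y ↔ A.Adj x y ∨ s(x, y) = s(v, w)) ∧
      ManyNbrs A (t - 1) v Set.univ := by
  classical
  obtain ⟨e, he, hB, φ, e', he', hφ⟩ := h
  have hadj : ∀ x y, B.Adj x y ↔ A.Adj x y ∨ s(x, y) = e := fun x y => by
    rw [← SimpleGraph.mem_edgeSet, hB, Set.mem_insert_iff, SimpleGraph.mem_edgeSet, or_comm]
  have key : ∀ i : Fin t, e = s(φ (.inl 0), φ (.inr i)) →
      ∃ v w, (∀ x y, B.Adj x y ↔ A.Adj x y ∨ s(x, y) = s(v, w)) ∧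
        ManyNbrs A (t - 1) v Set.univ := by
    rintro i rfl
    refine ⟨_, _, hadj, (Finset.univ.erase i).image fun j => φ (.inr j), ?_, ?_⟩
    · rw [Finset.card_image_of_injective, Finset.card_erase_of_mem (Finset.mem_univ _),
        Finset.card_univ, Fintype.card_fin]
      exact φ.injective.comp Sum.inr_injective
    · intro u hu
      obtain ⟨j, hj, rfl⟩ := Finset.mem_image.1 hu
      have hji : j ≠ i := (Finset.mem_erase.1 hj).1
      have h1 : B.Adj (φ (.inl 0)) (φ (.inr j)) := φ.toHom.map_adj (by simp)
      refine ⟨((hadj _ _).1 h1).resolve_right fun h => hji ?_, trivial⟩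
      have : φ (.inr j) = φ (.inr i) := by
        rcases Sym2.eq_iff.1 h with h | h
        · exact h.2
        · exact h.2.trans h.1
      exact Sum.inr_injective (φ.injective this)
  induction e' using Sym2.ind with
  | _ a b =>
    rcases a with a | a <;> rcases b with b | b
    · simp at he'
    · obtain rfl : a = 0 := Subsingleton.elim _ _
      exact key b (by rw [← hφ]; rfl)
    · obtain rfl : b = 0 := Subsingleton.elim _ _
      exact key a (by rw [← hφ, Sym2.eq_swap]; rfl)
    · simp at he'

/-- The new neighbour `w` is not among the old ones, so it completes t - 1 of them to the leaves of
a star. -/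
theorem bootstrapStep_sup_edge {t : ℕ} (ht : 1 ≤ t) {A : SimpleGraph V} {v w : V} (hvw : v ≠ w)
    (hA : ¬ A.Adj v w) (h : ManyNbrs A (t - 1) v Set.univ) :
    BootstrapStep (starGraphK t) A (A ⊔ SimpleGraph.edge v w) := by
  classical
  obtain ⟨T, hT, hadj⟩ := h
  obtain ⟨T', hT', hc⟩ := Finset.exists_subset_card_eq hT
  have hwT : w ∉ T' := fun h => hA (hadj w (hT' h)).1
  have hcard : (insert w T').card = t := by rw [Finset.card_insert_of_notMem hwT, hc]; omega
  let ψ : Fin t ≃ (insert w T' : Finset V) := ((insert w T').equivFinOfCardEq hcard).symm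
  have hψ : ∀ i, (A ⊔ SimpleGraph.edge v w).Adj v (ψ i) := fun i => by
    rcases Finset.mem_insert.1 (ψ i).2 with h | h
    · right; rw [h]; simp [SimpleGraph.edge_adj, hvw]
    · left; exact (hadj _ (hT' h)).1
  let φ : SimpleGraph.Copy (starGraphK t) (A ⊔ SimpleGraph.edge v w) :=
    { toHom :=
        { toFun := Sum.elim (fun _ => v) fun i => (ψ i : V)
          map_rel' := by
            rintro (a | a) (b | b) hab
            · simp at hab
            · exact hψ b
            · exact (hψ a).symm
            · simp at hab }
      injective' := by
        rintro (a | a) (b | b) hab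
        · rw [Subsingleton.elim a b]
        · exact absurd hab (hψ b).ne
        · exact absurd hab.symm (hψ a).ne
        · exact congrArg _ (ψ.injective (Subtype.ext hab)) }
  refine ⟨s(v, w), hA, ?_, φ, s(.inl 0, .inr (ψ.symm ⟨w, Finset.mem_insert_self _ _⟩)), by simp, ?_⟩
  · ext e
    induction e using Sym2.ind with
    | _ x y =>
      simp only [SimpleGraph.mem_edgeSet, SimpleGraph.sup_adj, SimpleGraph.edge_adj,
        Set.mem_insert_iff, Sym2.eq_iff]
      constructor
      · rintro (h | h)
        · exact Or.inr h
        · left; tauto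
      · rintro (h | h)
        · right
          refine ⟨by tauto, ?_⟩
          rintro rfl
          rcases h with h | h
          · exact hvw (h.1.symm.trans h.2)
          · exact hvw (h.2.symm.trans h.1)
        · exact Or.inl h
  · change s(v, ((ψ (ψ.symm ⟨w, Finset.mem_insert_self _ _⟩) : (insert w T' : Finset V)) : V)) = _
    rw [ψ.apply_symm_apply]

/-- If every vertex of a percolating set `S` has degree at least `t - 1` in `F`, then `F` is weakly
saturated for the star with `t` leaves. -/
theorem isWeaklySaturated_star [Finite V] {t : ℕ} (ht : 1 ≤ t) {F G : SimpleGraph V} (hFG : F ≤ G)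
    {S : Set V} (hS : ∀ v ∈ S, ManyNbrs F (t - 1) v Set.univ)
    (hperc : ∀ Z, S ⊆ Z → PercClosed G (t - 1) Z → Z = Set.univ) :
    IsWeaklySaturated G (starGraphK t) F := by
  refine ⟨hFG, ?_⟩
  let R : Set (SimpleGraph V) :=
    {H | Relation.ReflTransGen (BootstrapStep (starGraphK t)) F H ∧ F ≤ H ∧ H ≤ G}
  -- A maximal reachable graph replaces an explicit schedule of edge additions; it remains to see
  -- that it is `G`.
  obtain ⟨H, hH⟩ := (Set.toFinite R).exists_maximal ⟨F, Relation.ReflTransGen.refl, le_rfl, hFG⟩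
  have hmax : ∀ v, ManyNbrs H (t - 1) v Set.univ → ∀ w, G.Adj v w → H.Adj v w := by
    intro v hv w hvw
    by_contra hn
    have hstep := bootstrapStep_sup_edge ht hvw.ne hn hv
    have hle : H ⊔ SimpleGraph.edge v w ≤ H := hH.2
      ⟨hH.1.1.tail hstep, hH.1.2.1.trans le_sup_left,
        sup_le hH.1.2.2 ((SimpleGraph.edge_le_iff (G := G)).2 (Or.inr hvw))⟩ le_sup_left
    exact hn (hle (Or.inr (by simp [SimpleGraph.edge_adj, hvw.ne])))
  -- The vertices all of whose `G`-edges are in `H` form a closed set: a vertex with t - 1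
  -- neighbours of this kind has degree at least t - 1 in `H`.
  have huniv := hperc {v | ∀ w, G.Adj v w → H.Adj v w}
    (fun v hv => hmax v ((hS v hv).mono hH.1.2.1 subset_rfl)) fun v ⟨T, hT, hadj⟩ =>
      hmax v ⟨T, hT, fun u hu => ⟨((hadj u hu).2 v (hadj u hu).1.symm).symm, trivial⟩⟩
  have : H = G := le_antisymm hH.1.2.2 fun v w hvw => by
    have : v ∈ {v | ∀ w, G.Adj v w → H.Adj v w} := huniv ▸ Set.mem_univ v
    exact this w hvw
  exact this ▸ hH.1.1

theorem wsat_le {W : Type*} [Finite V] {G F : SimpleGraph V} {H : SimpleGraph W}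
    (h : IsWeaklySaturated G H F) : wsat G H ≤ F.edgeSet.ncard :=
  Nat.sInf_le ⟨F, h, rfl⟩

theorem exists_ncard_eq_wsat {W : Type*} [Finite V] (G : SimpleGraph V) (H : SimpleGraph W) :
    ∃ F, IsWeaklySaturated G H F ∧ F.edgeSet.ncard = wsat G H :=
  Nat.sInf_mem (s := {m | ∃ F, IsWeaklySaturated G H F ∧ F.edgeSet.ncard = m})
    ⟨_, G, ⟨le_rfl, Relation.ReflTransGen.refl⟩, rfl⟩

/-- The vertices of `A` can be activated one after another in `G` when initially only the edges of
`F` are present: when it is activated, each vertex has at least `r` edges that are in `F` or lead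
to earlier vertices. -/
inductive Activation (G F : SimpleGraph V) (r : ℕ) : Finset V → Prop
  | empty : Activation G F r ∅
  | cons {A : Finset V} {v : V} (hv : v ∉ A) (hA : Activation G F r A) (T : Finset V)
      (hT : r ≤ T.card) (hadj : ∀ u ∈ T, G.Adj v u ∧ (u ∈ A ∨ F.Adj v u)) :
      Activation G F r (Finset.cons v A hv)

theorem Activation.eq_empty {G F : SimpleGraph V} {r : ℕ} {A : Finset V} (h : Activation G F r A)
    (hG : ∀ v, ¬ ManyNbrs G r v Set.univ) : A = ∅ := by
  cases h with
  | empty => rfl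
  | cons hv hA T hT hadj => exact absurd ⟨T, hT, fun u hu => ⟨(hadj u hu).1, trivial⟩⟩ (hG _)

/-- Replay the process and activate the star centre of each added edge unless it is active already.
Its earlier edges are in `F` or meet `A`; as the centre itself is not in `A`, the other end is. -/
theorem IsWeaklySaturated.exists_activation {t : ℕ} {F G : SimpleGraph V}
    (h : IsWeaklySaturated G (starGraphK t) F) :
    ∃ A, Activation G F (t - 1) A ∧ ∀ x y, G.Adj x y → F.Adj x y ∨ x ∈ A ∨ y ∈ A := by
  classical
  have key : ∀ H, Relation.ReflTransGen (BootstrapStep (starGraphK t)) F H → H ≤ G →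
      ∃ A, Activation G F (t - 1) A ∧ ∀ x y, H.Adj x y → F.Adj x y ∨ x ∈ A ∨ y ∈ A := by
    intro H hH
    induction hH with
    | refl => exact fun _ => ⟨∅, .empty, fun x y h => Or.inl h⟩
    | tail _ hstep ih =>
      intro hle
      obtain ⟨v, w, hadj, T, hT, hnbr⟩ := hstep.star_adj
      rename_i B C _
      have hBC : B ≤ C := fun x y h => (hadj x y).2 (Or.inl h)
      obtain ⟨A, hA, hcov⟩ := ih (hBC.trans hle)
      by_cases hv : v ∈ A
      · refine ⟨A, hA, fun x y hxy => ?_⟩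
        rcases (hadj x y).1 hxy with h | h
        · exact hcov x y h
        · rcases Sym2.eq_iff.1 h with ⟨rfl, _⟩ | ⟨_, rfl⟩ <;> tauto
      · refine ⟨Finset.cons v A hv, .cons hv hA T hT fun u hu => ?_, fun x y hxy => ?_⟩
        · have h1 := (hnbr u hu).1
          refine ⟨hle (hBC h1), ?_⟩
          have := hcov v u h1
          tauto
        · simp only [Finset.mem_cons]
          rcases (hadj x y).1 hxy with h | h
          · have := hcov x y h
            tauto
          · rcases Sym2.eq_iff.1 h with ⟨rfl, _⟩ | ⟨_, rfl⟩ <;> tauto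
  exact key G h.2 le_rfl

theorem Activation.exists_subset {G F : SimpleGraph V} {r : ℕ} {A : Finset V}
    (h : Activation G F r A) {m : ℕ} (hm : m ≤ A.card) :
    ∃ B ⊆ A, B.card = m ∧ Activation G F r B := by
  induction h with
  | empty => exact ⟨∅, subset_rfl, by simpa [eq_comm] using hm, .empty⟩
  | cons hv hA T hT hadj ih =>
    rw [Finset.card_cons] at hm
    rcases hm.lt_or_eq with h | h
    · obtain ⟨B, hB, h1, h2⟩ := ih (Nat.lt_succ_iff.1 h)
      exact ⟨B, hB.trans (Finset.subset_cons hv), h1, h2⟩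
    · exact ⟨_, subset_rfl, by rw [Finset.card_cons, h], .cons hv hA T hT hadj⟩

/-- The edges of `F` that meet `A`. -/
def touching (F : SimpleGraph V) (A : Set V) : Set (Sym2 V) := {e ∈ F.edgeSet | ∃ v ∈ A, v ∈ e}

/-- The edges of `G` with both ends in `A`. -/
def inside (G : SimpleGraph V) (A : Set V) : Set (Sym2 V) := {e ∈ G.edgeSet | ∀ v ∈ e, v ∈ A}

theorem ncard_touching_cons [Finite V] {F : SimpleGraph V} {A : Finset V} {v : V} (hv : v ∉ A)
    {T : Finset V} (hT : ∀ u ∈ T, u ∉ A ∧ F.Adj v u) :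
    (touching F A).ncard + T.card ≤ (touching F (Finset.cons v A hv)).ncard := by
  classical
  have hinj : Function.Injective fun u : V => s(v, u) := fun a b h => Sym2.congr_right.1 h
  rw [← Set.ncard_coe_finset T, ← Set.ncard_image_of_injective _ hinj, ← Set.ncard_union_eq]
  · refine Set.ncard_le_ncard ?_ (Set.toFinite _)
    rintro e (⟨he, x, hx, hxe⟩ | ⟨u, hu, rfl⟩)
    · exact ⟨he, x, by simpa using Or.inr hx, hxe⟩
    · exact ⟨(hT u hu).2, v, by simp, by simp⟩
  · rw [Set.disjoint_left]
    rintro e ⟨_, x, hx, hxe⟩ ⟨u, hu, rfl⟩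
    rcases Sym2.mem_iff.1 hxe with rfl | rfl
    · exact hv hx
    · exact (hT _ hu).1 hx

theorem ncard_inside_cons [Finite V] {G : SimpleGraph V} {A : Finset V} {v : V} (hv : v ∉ A)
    {T : Finset V} (hT : ∀ u ∈ T, u ∈ A ∧ G.Adj v u) :
    (inside G A).ncard + T.card ≤ (inside G (Finset.cons v A hv)).ncard := by
  classical
  have hinj : Function.Injective fun u : V => s(v, u) := fun a b h => Sym2.congr_right.1 h
  rw [← Set.ncard_coe_finset T, ← Set.ncard_image_of_injective _ hinj, ← Set.ncard_union_eq]
  · refine Set.ncard_le_ncard ?_ (Set.toFinite _)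
    rintro e (⟨he, hx⟩ | ⟨u, hu, rfl⟩)
    · exact ⟨he, fun x hxe => by simpa using Or.inr (hx x hxe)⟩
    · refine ⟨(hT u hu).2, fun x hx => ?_⟩
      rcases Sym2.mem_iff.1 hx with rfl | rfl
      · simp
      · simpa using Or.inr (hT _ hu).1
  · rw [Set.disjoint_left]
    rintro e ⟨_, hx⟩ ⟨u, hu, rfl⟩
    exact hv (hx v (by simp))

/-- Of the r edges used by a new vertex, at most `A.card` go to `A`; the others are edges of `F` not
counted before. Truncated subtraction gives 0 once r vertices are active. -/
theorem Activation.le_ncard_touching [Finite V] {G F : SimpleGraph V} {r : ℕ} {A : Finset V}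
    (h : Activation G F r A) : ∑ i ∈ Finset.range A.card, (r - i) ≤ (touching F A).ncard := by
  classical
  induction h with
  | empty => simp
  | @cons A v hv hA T hT hadj ih =>
    have h1 := ncard_touching_cons (F := F) hv (T := T.filter (· ∉ A)) fun u hu => by
      rw [Finset.mem_filter] at hu
      have := hadj u hu.1
      tauto
    have h2 := Finset.card_filter_add_card_filter_not (s := T) (fun u => u ∈ A)
    have h3 : (T.filter fun u => u ∈ A).card ≤ A.card :=
      Finset.card_le_card fun u hu => (Finset.mem_filter.1 hu).2
    rw [Finset.card_cons, Finset.sum_range_succ]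
    omega

/-- Each of the r edges used at an activation is new either inside the active set or among the
`F`-edges touching it. With few edges in `F`, a long activation therefore spans a dense set. -/
theorem Activation.le_ncard_inside_add [Finite V] {G F : SimpleGraph V} {r : ℕ} {A : Finset V}
    (h : Activation G F r A) : r * A.card ≤ (inside G A).ncard + (touching F A).ncard := by
  classical
  induction h with
  | empty => simp
  | @cons A v hv hA T hT hadj ih =>
    have h1 := ncard_touching_cons (F := F) hv (T := T.filter (· ∉ A)) fun u hu => by
      rw [Finset.mem_filter] at hu
      have := hadj u hu.1
      tauto
    have h0 := ncard_inside_cons (G := G) hv (T := T.filter (· ∈ A)) fun u hu => by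
      rw [Finset.mem_filter] at hu
      exact ⟨hu.2, (hadj u hu.1).1⟩
    have h2 := Finset.card_filter_add_card_filter_not (s := T) (fun u => u ∈ A)
    rw [Finset.card_cons, mul_add, mul_one]
    omega

theorem sum_range_sub_add_choose {r k : ℕ} (hk : k ≤ r) :
    ∑ i ∈ Finset.range k, (r - i) + (r + 1 - k).choose 2 = (r + 1).choose 2 := by
  induction k with
  | zero => simp
  | succ k ih =>
    rw [← ih (by omega), Finset.sum_range_succ, show r + 1 - k = (r - k) + 1 by omega,
      Nat.choose_succ_succ' (r - k) 1, Nat.choose_one_right, show r + 1 - (k + 1) = r - k by omega]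
    ring

/-- If at least t - 1 vertices are activated, the first t - 1 already force binom(t,2) edges of `F`.
Otherwise the active set plays the role of `U`: edges avoiding it belong to `F` and make up exactly
for the missing terms of the sum. -/
theorem choose_two_le_wsat_star [Finite V] {t : ℕ} (ht : 1 ≤ t) {G : SimpleGraph V}
    (hG : ∀ U : Finset V, U.card < t - 1 →
      (t - U.card).choose 2 ≤ (inside G (U : Set V)ᶜ).ncard) :
    t.choose 2 ≤ wsat G (starGraphK t) := by
  classical
  obtain ⟨F, hF, hcard⟩ := exists_ncard_eq_wsat G (starGraphK t)
  obtain ⟨A, hA, hcov⟩ := hF.exists_activation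
  obtain ⟨r, rfl⟩ : ∃ r, t = r + 1 := ⟨t - 1, by omega⟩
  rw [← hcard]
  rw [Nat.add_sub_cancel] at hA hG
  by_cases hr : r ≤ A.card
  · obtain ⟨B, -, hB, hact⟩ := hA.exists_subset hr
    have h1 := hact.le_ncard_touching
    have h2 := sum_range_sub_add_choose (le_refl r)
    rw [hB] at h1
    rw [show r + 1 - r = 1 by omega, show Nat.choose 1 2 = 0 from rfl, add_zero] at h2
    rw [← h2]
    exact h1.trans (Set.ncard_le_ncard (fun e he => he.1) (Set.toFinite _))
  · push Not at hr
    have h1 := hA.le_ncard_touching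
    have h2 := hG A hr
    rw [← sum_range_sub_add_choose hr.le]
    refine (add_le_add h1 h2).trans ?_
    rw [← Set.ncard_union_eq]
    · refine Set.ncard_le_ncard ?_ (Set.toFinite _)
      rintro e (he | ⟨he, hx⟩)
      · exact he.1
      · induction e using Sym2.ind with
        | _ x y =>
          have hx1 := hx x (by simp)
          have hx2 := hx y (by simp)
          have := hcov x y he
          simp only [Set.mem_compl_iff, Finset.mem_coe] at hx1 hx2
          simp only [SimpleGraph.mem_edgeSet]
          tauto
    · rw [Set.disjoint_left]
      rintro e ⟨_, x, hx, hxe⟩ ⟨_, hy⟩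
      exact hy x hxe hx

/-- The set of all pairs of distinct elements of `S`. -/
def pairsIn [DecidableEq V] (S : Finset V) : Finset (Sym2 V) :=
  S.offDiag.image (Function.uncurry Sym2.mk)

theorem mem_pairsIn [DecidableEq V] {S : Finset V} {x y : V} :
    s(x, y) ∈ pairsIn S ↔ x ∈ S ∧ y ∈ S ∧ x ≠ y := by
  simp only [pairsIn, Finset.mem_image, Finset.mem_offDiag, Prod.exists, Function.uncurry_apply_pair,
    Sym2.eq_iff]
  constructor
  · rintro ⟨a, b, h, ⟨rfl, rfl⟩ | ⟨rfl, rfl⟩⟩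
    · exact h
    · exact ⟨h.2.1, h.1, h.2.2.symm⟩
  · exact fun h => ⟨x, y, h, Or.inl ⟨rfl, rfl⟩⟩

theorem card_pairsIn [DecidableEq V] (S : Finset V) : (pairsIn S).card = S.card.choose 2 :=
  Sym2.card_image_offDiag S

/-- A percolating clique on `t - 1` vertices yields a small weakly saturated subgraph. -/
theorem wsat_star_le_choose_two [Finite V] {t : ℕ} (ht : 1 ≤ t) {G : SimpleGraph V} {S : Finset V}
    (hS : S.card = t - 1) (hclique : ∀ u ∈ S, ∀ v ∈ S, u ≠ v → G.Adj u v)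
    (hout : ∀ v ∈ S, ∃ w, w ∉ S ∧ G.Adj v w)
    (hperc : ∀ Z : Set V, ↑S ⊆ Z → PercClosed G (t - 1) Z → Z = Set.univ) :
    wsat G (starGraphK t) ≤ t.choose 2 := by
  classical
  choose! g hgS hgG using hout
  -- Each vertex of `S` has t - 2 neighbours in the clique, and the outward edge raises its degree
  -- to t - 1.
  let E : Finset (Sym2 V) := pairsIn S ∪ S.image fun v => s(v, g v)
  have hE : ∀ x y, s(x, y) ∈ E → G.Adj x y := by
    intro x y h
    rcases Finset.mem_union.1 h with h | h
    · rw [mem_pairsIn] at h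
      exact hclique x h.1 y h.2.1 h.2.2
    · obtain ⟨v, hv, h⟩ := Finset.mem_image.1 h
      rw [← SimpleGraph.mem_edgeSet, ← h]
      exact hgG v hv
  have hadj : ∀ x y, (SimpleGraph.fromEdgeSet (E : Set (Sym2 V))).Adj x y ↔ s(x, y) ∈ E := by
    intro x y
    simp only [SimpleGraph.fromEdgeSet_adj, Finset.mem_coe, and_iff_left_iff_imp]
    exact fun h => (hE x y h).ne
  refine (wsat_le (isWeaklySaturated_star ht (F := SimpleGraph.fromEdgeSet (E : Set (Sym2 V)))
    (fun x y h => hE x y ((hadj x y).1 h)) (S := S) (fun v hv => ?_) hperc)).trans ?_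
  · refine ⟨insert (g v) (S.erase v), ?_, fun u hu => ⟨(hadj v u).2 ?_, trivial⟩⟩
    · rw [Finset.card_insert_of_notMem fun h => hgS v hv (Finset.mem_of_mem_erase h),
        Finset.card_erase_of_mem hv]
      omega
    · rcases Finset.mem_insert.1 hu with rfl | hu
      · exact Finset.mem_union_right _ (Finset.mem_image_of_mem _ hv)
      · refine Finset.mem_union_left _ ?_
        exact mem_pairsIn.2 ⟨hv, Finset.mem_of_mem_erase hu, (Finset.ne_of_mem_erase hu).symm⟩
  · have h1 : (SimpleGraph.fromEdgeSet (E : Set (Sym2 V))).edgeSet ⊆ E := by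
      rw [SimpleGraph.edgeSet_fromEdgeSet]
      exact Set.sdiff_subset
    refine (Set.ncard_le_ncard h1 (Set.toFinite _)).trans ?_
    rw [Set.ncard_coe_finset]
    refine (Finset.card_union_le _ _).trans ?_
    obtain ⟨r, rfl⟩ : ∃ r, t = r + 1 := ⟨t - 1, by omega⟩
    have h3 : (r + 1).choose 2 = r.choose 1 + r.choose 2 := Nat.choose_succ_succ' r 1
    rw [Nat.choose_one_right] at h3
    have h4 := Finset.card_image_le (s := S) (f := fun v => s(v, g v))
    rw [card_pairsIn, hS, Nat.add_sub_cancel]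
    rw [hS, Nat.add_sub_cancel] at h4
    omega

end StarPercolation

/-! ### The complete graph. -/

theorem wsat_top_star {n t : ℕ} (ht : 1 ≤ t) (hn : t ≤ n) :
    wsat (⊤ : SimpleGraph (Fin n)) (starGraphK t) = t.choose 2 := by
  classical
  refine le_antisymm ?_ (choose_two_le_wsat_star ht fun U hU => ?_)
  · obtain ⟨S, -, hS⟩ := Finset.exists_subset_card_eq (s := (Finset.univ : Finset (Fin n)))
      (n := t - 1) (by simp; omega)
    refine wsat_star_le_choose_two ht hS (fun u _ v _ h => h) (fun v hv => ?_) fun Z hZ hcl => ?_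
    · obtain ⟨w, hw⟩ : ∃ w, w ∉ S := by
        by_contra! h
        have := Finset.eq_univ_iff_forall.2 h
        rw [this, Finset.card_univ, Fintype.card_fin] at hS
        omega
      exact ⟨w, hw, fun h => hw (h ▸ hv)⟩
    · refine Set.eq_univ_of_forall fun v => ?_
      by_cases hv : v ∈ S
      · exact hZ hv
      · exact hcl v ⟨S, hS.ge, fun u hu => ⟨fun h => hv (h ▸ hu), hZ hu⟩⟩
  · have : inside (⊤ : SimpleGraph (Fin n)) (U : Set (Fin n))ᶜ = (pairsIn Uᶜ : Finset _) := by
      ext e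
      induction e using Sym2.ind with
      | _ x y =>
        rw [Finset.mem_coe, mem_pairsIn]
        simp only [inside, Set.mem_ofPred_eq, SimpleGraph.mem_edgeSet, SimpleGraph.top_adj,
          Sym2.mem_iff, Finset.mem_compl, Set.mem_compl_iff, Finset.mem_coe, forall_eq_or_imp,
          forall_eq]
        tauto
    rw [this, Set.ncard_coe_finset, card_pairsIn, Finset.card_compl, Fintype.card_fin]
    exact Nat.choose_le_choose 2 (by omega)

/-! ### Growing a nucleus by exposing edges layer by layer, with restarts. -/

section Growth

variable {V : Type*} [DecidableEq V]

/-- The neighbours of `v` in `A`, with respect to the edge set `ω`. -/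
def nbrsIn (ω : Finset (Sym2 V)) (A : Finset V) (v : V) : Finset V := A.filter fun u => s(u, v) ∈ ω

theorem mem_nbrsIn {ω : Finset (Sym2 V)} {A : Finset V} {u v : V} :
    u ∈ nbrsIn ω A v ↔ u ∈ A ∧ s(u, v) ∈ ω := Finset.mem_filter

theorem nbrsIn_mono {ω ω' : Finset (Sym2 V)} (h : ω ⊆ ω') (A : Finset V) (v : V) :
    nbrsIn ω A v ⊆ nbrsIn ω' A v := fun _ hu =>
  mem_nbrsIn.2 ⟨(mem_nbrsIn.1 hu).1, h (mem_nbrsIn.1 hu).2⟩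

/-- A set of vertices that can be listed so that each vertex is adjacent to at least `r` of its
predecessors, or to all of them if there are fewer than `r`. -/
inductive Built (r : ℕ) (ω : Finset (Sym2 V)) : Finset V → Prop
  | empty : Built r ω ∅
  | cons {A : Finset V} {v : V} (hv : v ∉ A) (hA : Built r ω A)
      (h : min A.card r ≤ (nbrsIn ω A v).card) : Built r ω (Finset.cons v A hv)

theorem Built.mono {r : ℕ} {ω ω' : Finset (Sym2 V)} (hω : ω ⊆ ω') {A : Finset V}
    (h : Built r ω A) : Built r ω' A := by
  induction h with
  | empty => exact .empty
  | cons hv hA h ih => exact .cons hv ih (h.trans (Finset.card_le_card (nbrsIn_mono hω _ _)))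

theorem manyNbrs_edgeGraph {ω : Finset (Sym2 V)} {r : ℕ} {v : V} {A : Finset V} {Z : Set V}
    (hv : v ∉ A) (h : r ≤ (nbrsIn ω A v).card) (hZ : ↑A ⊆ Z) : ManyNbrs (edgeGraph ω) r v Z := by
  refine ⟨_, h, fun u hu => ?_⟩
  rw [mem_nbrsIn] at hu
  refine ⟨?_, hZ hu.1⟩
  rw [SimpleGraph.fromEdgeSet_adj, Sym2.eq_swap]
  exact ⟨hu.2, fun h => hv (h ▸ hu.1)⟩

theorem Built.isClique {r : ℕ} {ω : Finset (Sym2 V)} {A : Finset V} (h : Built r ω A)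
    (hr : A.card ≤ r) : ∀ u ∈ A, ∀ v ∈ A, u ≠ v → (edgeGraph ω).Adj u v := by
  induction h with
  | empty => simp
  | @cons A v hv hA h ih =>
    rw [Finset.card_cons] at hr
    have hall : ∀ u ∈ A, s(u, v) ∈ ω := by
      rw [min_eq_left (by omega)] at h
      have := Finset.eq_of_subset_of_card_le (Finset.filter_subset _ _) h
      intro u hu
      rw [← this] at hu
      exact (Finset.mem_filter.1 hu).2
    intro x hx y hy hxy
    rw [Finset.mem_cons] at hx hy
    rcases hx with rfl | hx <;> rcases hy with rfl | hy
    · exact absurd rfl hxy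
    · rw [SimpleGraph.fromEdgeSet_adj, Sym2.eq_swap]
      exact ⟨hall y hy, hxy⟩
    · rw [SimpleGraph.fromEdgeSet_adj]
      exact ⟨hall x hx, hxy⟩
    · exact ih (by omega) x hx y hy hxy

/-- `S` consists of the first r vertices in the building order; every later one is infected by its
predecessors. -/
theorem Built.exists_clique {r : ℕ} {ω : Finset (Sym2 V)} {A : Finset V} (h : Built r ω A)
    (hr : r ≤ A.card) : ∃ S : Finset V, S.card = r ∧
      (∀ u ∈ S, ∀ v ∈ S, u ≠ v → (edgeGraph ω).Adj u v) ∧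
      ∀ Z : Set V, ↑S ⊆ Z → PercClosed (edgeGraph ω) r Z → ↑A ⊆ Z := by
  induction h with
  | empty =>
    obtain rfl : r = 0 := by simpa using hr
    exact ⟨∅, rfl, by simp, by simp⟩
  | @cons A v hv hA h ih =>
    by_cases hr' : r ≤ A.card
    · obtain ⟨S, hS, hcl, hZ⟩ := ih hr'
      refine ⟨S, hS, hcl, fun Z hSZ hc => ?_⟩
      have hAZ := hZ Z hSZ hc
      rw [Finset.coe_cons, Set.insert_subset_iff]
      rw [min_eq_right hr'] at h
      exact ⟨hc v (manyNbrs_edgeGraph hv h hAZ), hAZ⟩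
    · have hc : (Finset.cons v A hv).card = r := by
        rw [Finset.card_cons] at hr ⊢
        omega
      exact ⟨_, hc, (Built.cons hv hA h).isClique hc.le, fun Z hZ _ => hZ⟩

/-- The pairs consisting of an element of `A` and the vertex `v`. -/
def starPairs (A : Finset V) (v : V) : Finset (Sym2 V) := A.image fun u => s(u, v)

theorem card_starPairs (A : Finset V) (v : V) : (starPairs A v).card = A.card :=
  Finset.card_image_of_injective _ fun _ _ h => Sym2.congr_left.1 h

theorem card_nbrsIn {A : Finset V} {v : V} {ω : Finset (Sym2 V)} (h : ω ⊆ starPairs A v) :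
    (nbrsIn ω A v).card = ω.card := by
  have : (nbrsIn ω A v).image (fun u => s(u, v)) = ω := by
    ext e
    simp only [Finset.mem_image, mem_nbrsIn]
    constructor
    · rintro ⟨u, hu, rfl⟩
      exact hu.2
    · intro he
      obtain ⟨u, hu, rfl⟩ := Finset.mem_image.1 (h he)
      exact ⟨u, ⟨hu, he⟩, rfl⟩
  rw [← this, Finset.card_image_of_injective _ fun _ _ h => Sym2.congr_left.1 h, this]

/-- The pairs consisting of an element of `A` and an element of `W`. -/
def crossPairs (A W : Finset V) : Finset (Sym2 V) := W.biUnion (starPairs A)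

theorem mem_crossPairs {A W : Finset V} {e : Sym2 V} :
    e ∈ crossPairs A W ↔ ∃ u ∈ A, ∃ v ∈ W, s(u, v) = e := by
  simp only [crossPairs, starPairs, Finset.mem_biUnion, Finset.mem_image]
  constructor
  · rintro ⟨v, hv, u, hu, h⟩
    exact ⟨u, hu, v, hv, h⟩
  · rintro ⟨u, hu, v, hv, h⟩
    exact ⟨v, hv, u, hu, h⟩

theorem mk_mem_crossPairs {A W : Finset V} {x y : V} :
    s(x, y) ∈ crossPairs A W ↔ (x ∈ A ∧ y ∈ W) ∨ (y ∈ A ∧ x ∈ W) := by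
  rw [mem_crossPairs]
  constructor
  · rintro ⟨u, hu, v, hv, h⟩
    rcases Sym2.eq_iff.1 h with ⟨rfl, rfl⟩ | ⟨rfl, rfl⟩
    · exact Or.inl ⟨hu, hv⟩
    · exact Or.inr ⟨hu, hv⟩
  · rintro (h | h)
    · exact ⟨x, h.1, y, h.2, rfl⟩
    · exact ⟨y, h.1, x, h.2, Sym2.eq_swap⟩

theorem bprob_union_and {α : Type*} [DecidableEq α] {s t : Finset α} (h : Disjoint s t) (p : ℝ)
    {R P Q : Finset α → Prop} (hR : ∀ a ⊆ s, ∀ b ⊆ t, (R (a ∪ b) ↔ P a ∧ Q b)) :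
    bprob (s ∪ t) p R = bprob s p P * bprob t p Q := by
  rw [bprob, bexp_union h, mul_comm]
  unfold bprob
  rw [← bexp_const_mul]
  refine bexp_congr fun a ha => ?_
  rw [mul_comm, ← bexp_const_mul]
  refine bexp_congr fun b hb => ?_
  have := hR a ha b hb
  by_cases h1 : P a <;> by_cases h2 : Q b <;> simp [h1, h2, this]

/-- All vertices of `W` simultaneously having fewer than `d` neighbours in `A`. -/
theorem bprob_forall_card_nbrsIn_lt {A W : Finset V} (hAW : Disjoint A W) {p x : ℝ} (h0 : 0 ≤ p)
    (h1 : p ≤ 1) (d : ℕ)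
    (hx : ∀ v ∈ W, bprob (starPairs A v) p (fun ω => ω.card < d) ≤ x) :
    bprob (crossPairs A W) p (fun ω => ∀ v ∈ W, (nbrsIn ω A v).card < d) ≤ x ^ W.card := by
  induction W using Finset.induction_on with
  | empty =>
    simpa using bprob_le_one h0 h1 _
  | insert v W hv ih =>
    rw [Finset.disjoint_insert_right] at hAW
    have hc : crossPairs A (insert v W) = starPairs A v ∪ crossPairs A W := by
      simp [crossPairs, Finset.biUnion_insert]
    have hst : starPairs A v = crossPairs A {v} := by simp [crossPairs]
    have hdis : Disjoint (starPairs A v) (crossPairs A W) := by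
      rw [hst, Finset.disjoint_left]
      intro e
      induction e using Sym2.ind with
      | _ a b =>
        rw [mk_mem_crossPairs, mk_mem_crossPairs]
        simp only [Finset.mem_singleton]
        rintro (⟨h1, rfl⟩ | ⟨h1, rfl⟩) (⟨h3, h4⟩ | ⟨h3, h4⟩) <;> tauto
    rw [hc, bprob_union_and hdis p (P := fun a => a.card < d)
      (Q := fun b => ∀ w ∈ W, (nbrsIn b A w).card < d), Finset.card_insert_of_notMem hv, pow_succ,
      mul_comm]
    · refine mul_le_mul (ih hAW.2 fun w hw => hx w (Finset.mem_insert_of_mem hw))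
        (hx v (Finset.mem_insert_self _ _)) (bprob_nonneg h0 h1 _) ?_
      exact pow_nonneg ((bprob_nonneg h0 h1 _).trans (hx v (Finset.mem_insert_self _ _))) _
    · intro a ha b hb
      have e1 : nbrsIn (a ∪ b) A v = nbrsIn a A v := by
        ext u
        simp only [mem_nbrsIn, Finset.mem_union]
        have : u ∈ A → s(u, v) ∉ b := fun hu h => by
          have := mk_mem_crossPairs.1 (hb h)
          tauto
        tauto
      have e2 : ∀ w ∈ W, nbrsIn (a ∪ b) A w = nbrsIn b A w := by
        intro w hw
        ext u
        simp only [mem_nbrsIn, Finset.mem_union]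
        have : u ∈ A → s(u, w) ∉ a := fun hu h => by
          have := ha h
          rw [hst, mk_mem_crossPairs] at this
          simp only [Finset.mem_singleton] at this
          rcases this with ⟨_, rfl⟩ | ⟨_, rfl⟩
          · exact hv hw
          · exact hAW.1 hu
        tauto
      rw [Finset.forall_mem_insert, e1, card_nbrsIn ha]
      refine and_congr_right fun _ => forall₂_congr fun w hw => by rw [e2 w hw]

/-- One step of the exploration: if the edges between `A` and a set of size at least `n` are
exposed, then a vertex with many neighbours in `A` is found with probability at least `q`. -/
theorem bprob_no_candidate_le {A W : Finset V} (hAW : Disjoint A W) {p q : ℝ} (h0 : 0 ≤ p)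
    (h1 : p ≤ 1) {d n : ℕ} (hW : n ≤ W.card)
    (hq : (1 - (A.card.choose d : ℝ) * (p ^ d * (1 - p) ^ (A.card - d))) ^ n ≤ 1 - q) :
    bprob (crossPairs A W) p (fun ω => ∀ v ∈ W, (nbrsIn ω A v).card < d) ≤ 1 - q := by
  have hlow : ∀ v, (A.card.choose d : ℝ) * (p ^ d * (1 - p) ^ (A.card - d))
      ≤ bprob (starPairs A v) p (fun ω => d ≤ ω.card) := fun v => by
    simpa only [card_starPairs] using le_bprob_card (s := starPairs A v) h0 h1 d
  rcases W.eq_empty_or_nonempty with rfl | ⟨v, hv⟩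
  · obtain rfl : n = 0 := by simpa using hW
    exact (bprob_le_one h0 h1 _).trans (by simpa using hq)
  refine ((bprob_forall_card_nbrsIn_lt hAW h0 h1 d fun v _ => ?_).trans
    (pow_le_pow_of_le_one ?_ ?_ hW)).trans hq
  · have := bprob_not (starPairs A v) p (fun ω => d ≤ ω.card)
    simp only [not_le] at this
    rw [this]
    linarith [hlow v]
  · linarith [hlow v, bprob_le_one (s := starPairs A v) h0 h1 (fun ω => d ≤ ω.card)]
  · have : 0 ≤ 1 - p := by linarith
    have : (0 : ℝ) ≤ (A.card.choose d : ℝ) * (p ^ d * (1 - p) ^ (A.card - d)) := by positivity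
    linarith

/-- State of the exploration: `A` is the current attempt, `R` the discarded vertices, `s` the pairs
still random, `a` the edges known so far, `N` the restarts left. Exposed pairs always meet `A` or
`R`, so after moving `A` into `R` a restart sees only fresh pairs. The bound is the failure
probability of the running attempt times that of `N` complete ones. -/
theorem bprob_not_built_le_aux {r m : ℕ} {p : ℝ} (h0 : 0 ≤ p) (h1 : p ≤ 1) {L : ℕ → Finset V}
    (hL : ∀ i j, i ≠ j → Disjoint (L i) (L j)) {sz : ℕ → ℕ} {q : ℕ → ℝ}
    (hq0 : ∀ k < m, 0 ≤ q k) (hq1 : ∀ k < m, q k ≤ 1)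
    (hq : ∀ k < m, (1 - (k.choose (min k r) : ℝ) * (p ^ (min k r) * (1 - p) ^ (k - min k r))) ^ sz k
      ≤ 1 - q k) (N d : ℕ) :
    ∀ (A R : Finset V) (s a : Finset (Sym2 V)), A.card + d = m → Built r a A →
      (∀ u ∈ A, ∃ i < A.card, u ∈ L i) → Disjoint A R →
      (∀ i < m, ∀ k < m, i ≠ k → ∀ u ∈ L i, ∀ v ∈ L k, u ∉ R → u ∉ A → v ∉ R → v ∉ A →
        s(u, v) ∈ s) →
      (∀ u ∈ A, ∀ k < m, A.card ≤ k → ∀ v ∈ L k, v ∉ R → s(u, v) ∈ s) →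
      (∀ k < m, sz k + (R.card + N * m) ≤ (L k).card) →
      bprob s p (fun b => ¬ ∃ B : Finset V, B.card = m ∧ Built r (a ∪ b) B)
        ≤ (1 - ∏ k ∈ Finset.Ico A.card m, q k) * (1 - ∏ k ∈ Finset.Ico 0 m, q k) ^ N := by
  have hQ0 : ∀ j, 0 ≤ ∏ k ∈ Finset.Ico j m, q k := fun j =>
    Finset.prod_nonneg fun k hk => hq0 k (Finset.mem_Ico.1 hk).2
  have hQ1 : ∀ j, ∏ k ∈ Finset.Ico j m, q k ≤ 1 := fun j =>
    Finset.prod_le_one (fun k hk => hq0 k (Finset.mem_Ico.1 hk).2)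
      fun k hk => hq1 k (Finset.mem_Ico.1 hk).2
  -- Induction on the vertices still to be added, with the bound after a restart as a hypothesis; a
  -- restart discards at most m vertices, hence the extra `+ m`. The outer induction on `N` supplies
  -- that hypothesis.
  have main : ∀ N : ℕ, (∀ (R : Finset V) (s a : Finset (Sym2 V)),
      (∀ i < m, ∀ k < m, i ≠ k → ∀ u ∈ L i, ∀ v ∈ L k, u ∉ R → v ∉ R → s(u, v) ∈ s) →
      (∀ k < m, sz k + (R.card + N * m) ≤ (L k).card + m) →
      bprob s p (fun b => ¬ ∃ B : Finset V, B.card = m ∧ Built r (a ∪ b) B)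
        ≤ (1 - ∏ k ∈ Finset.Ico 0 m, q k) ^ N) →
      ∀ (d : ℕ) (A R : Finset V) (s a : Finset (Sym2 V)), A.card + d = m → Built r a A →
      (∀ u ∈ A, ∃ i < A.card, u ∈ L i) → Disjoint A R →
      (∀ i < m, ∀ k < m, i ≠ k → ∀ u ∈ L i, ∀ v ∈ L k, u ∉ R → u ∉ A → v ∉ R → v ∉ A →
        s(u, v) ∈ s) →
      (∀ u ∈ A, ∀ k < m, A.card ≤ k → ∀ v ∈ L k, v ∉ R → s(u, v) ∈ s) →
      (∀ k < m, sz k + (R.card + N * m) ≤ (L k).card) →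
      bprob s p (fun b => ¬ ∃ B : Finset V, B.card = m ∧ Built r (a ∪ b) B)
        ≤ (1 - ∏ k ∈ Finset.Ico A.card m, q k) * (1 - ∏ k ∈ Finset.Ico 0 m, q k) ^ N := by
    intro N hreset d
    induction d with
    | zero =>
      intro A R s a hA hB _ _ _ _ _
      have : bprob s p (fun b => ¬ ∃ B : Finset V, B.card = m ∧ Built r (a ∪ b) B)
          ≤ bexp s p (fun _ => 0) :=
        bexp_mono h0 h1 fun b _ => by
          rw [if_neg]
          exact fun h => h ⟨A, hA, hB.mono Finset.subset_union_left⟩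
      rw [bexp_const] at this
      refine this.trans (mul_nonneg (sub_nonneg.2 (hQ1 _)) (pow_nonneg (sub_nonneg.2 (hQ1 _)) _))
    | succ d ih =>
      intro A R s a hA hB hAL hAR hs hsA hsz
      have hj : A.card < m := by omega
      set W := L A.card \ R with hW
      have hAW : Disjoint A W := by
        rw [Finset.disjoint_left]
        intro u hu hu'
        obtain ⟨i, hi, hui⟩ := hAL u hu
        exact Finset.disjoint_left.1 (hL i A.card hi.ne) hui (Finset.mem_sdiff.1 hu').1
      have hs1 : crossPairs A W ⊆ s := by
        intro e he
        obtain ⟨u, hu, v, hv, rfl⟩ := mem_crossPairs.1 he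
        rw [hW, Finset.mem_sdiff] at hv
        exact hsA u hu A.card hj le_rfl v hv.1 hv.2
      have hWc : sz A.card ≤ W.card := by
        have := hsz A.card hj
        have := Finset.le_card_sdiff R (L A.card)
        rw [hW]
        omega
      have hcand := bprob_no_candidate_le hAW h0 h1 hWc (hq _ hj)
      set Q0 := ∏ k ∈ Finset.Ico 0 m, q k
      set Q1 := ∏ k ∈ Finset.Ico (A.card + 1) m, q k with hQ1def
      have hprod : ∏ k ∈ Finset.Ico A.card m, q k = q A.card * Q1 :=
        Finset.prod_eq_prod_Ico_succ_bot hj _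
      have hY : 0 ≤ (1 - Q0) ^ N := pow_nonneg (sub_nonneg.2 (hQ1 _)) _
      conv_lhs => rw [← Finset.union_sdiff_of_subset hs1]
      rw [bprob, bexp_union Finset.disjoint_sdiff]
      -- The right side is the restart bound if the layer offers no candidate and the bound for the
      -- enlarged set otherwise. Being affine in the indicator, it averages to the claim.
      have hpt : ∀ a1 ⊆ crossPairs A W,
          bprob (s \ crossPairs A W) p
            (fun b => ¬ ∃ B : Finset V, B.card = m ∧ Built r (a ∪ (a1 ∪ b)) B)
          ≤ (1 - Q1) * (1 - Q0) ^ N + Q1 * (1 - Q0) ^ N *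
            @ite ℝ (∀ v ∈ W, (nbrsIn a1 A v).card < min A.card r) (Classical.propDecidable _) 1 0 := by
        intro a1 ha1
        simp only [← Finset.union_assoc]
        split_ifs with hc
        · have hred : (1 - Q1) * (1 - Q0) ^ N + Q1 * (1 - Q0) ^ N * 1 = (1 - Q0) ^ N := by ring
          rw [hred]
          refine hreset (R ∪ A) _ _ (fun i hi k hk hik u hu v hv hu' hv' => ?_) fun k hk => ?_
          · rw [Finset.mem_union, not_or] at hu' hv'
            refine Finset.mem_sdiff.2
              ⟨hs i hi k hk hik u hu v hv hu'.1 hu'.2 hv'.1 hv'.2, fun h => ?_⟩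
            rw [mk_mem_crossPairs] at h
            tauto
          · have := hsz k hk
            have := Finset.card_union_le R A
            omega
        · push Not at hc
          obtain ⟨v, hv, hvc⟩ := hc
          have hvA : v ∉ A := fun h => Finset.disjoint_left.1 hAW h hv
          have hv' := Finset.mem_sdiff.1 hv
          have hcc : (Finset.cons v A hvA).card = A.card + 1 := Finset.card_cons _
          rw [mul_zero, add_zero, hQ1def, ← hcc]
          refine ih (Finset.cons v A hvA) R _ _ (by omega) ?_ ?_ ?_ ?_ ?_ hsz
          · exact .cons hvA (hB.mono Finset.subset_union_left)
              (hvc.trans (Finset.card_le_card (nbrsIn_mono Finset.subset_union_right _ _)))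
          · intro u hu
            rw [hcc]
            rcases Finset.mem_cons.1 hu with rfl | hu
            · exact ⟨_, Nat.lt_succ_self _, hv'.1⟩
            · obtain ⟨i, hi, hui⟩ := hAL u hu
              exact ⟨i, by omega, hui⟩
          · rw [Finset.cons_eq_insert, Finset.disjoint_insert_left]
            exact ⟨hv'.2, hAR⟩
          · intro i hi k hk hik x hx y hy hxR hxA hyR hyA
            rw [Finset.mem_cons, not_or] at hxA hyA
            refine Finset.mem_sdiff.2 ⟨hs i hi k hk hik x hx y hy hxR hxA.2 hyR hyA.2, fun h => ?_⟩
            rw [mk_mem_crossPairs] at h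
            tauto
          · intro u hu k hk hck y hy hyR
            rw [hcc] at hck
            have hyA : y ∉ A := fun h => by
              obtain ⟨i, hi, hui⟩ := hAL y h
              exact Finset.disjoint_left.1 (hL i k (by omega)) hui hy
            have hyW : y ∉ W := fun h =>
              Finset.disjoint_left.1 (hL A.card k (by omega)) (Finset.mem_sdiff.1 h).1 hy
            refine Finset.mem_sdiff.2 ⟨?_, fun h => ?_⟩
            · rcases Finset.mem_cons.1 hu with rfl | hu
              · exact hs _ hj k hk (by omega) u hv'.1 y hy hv'.2 hvA hyR hyA
              · exact hsA u hu k hk (by omega) y hy hyR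
            · rw [mk_mem_crossPairs] at h
              tauto
      refine (bexp_mono h0 h1 hpt).trans ?_
      rw [bexp_add, bexp_const, bexp_const_mul, hprod]
      have := mul_le_mul_of_nonneg_left hcand (mul_nonneg (hQ0 (A.card + 1)) hY)
      unfold bprob at this
      have h2 : (1 - q A.card * Q1) * (1 - Q0) ^ N
          = (1 - Q1) * (1 - Q0) ^ N + Q1 * (1 - Q0) ^ N * (1 - q A.card) := by ring
      rw [h2]
      exact add_le_add_right this _
  induction N generalizing d with
  | zero =>
    -- With no restart left the required bound is the zeroth power, which is 1.
    refine main 0 (fun R s a _ _ => ?_) d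
    simpa using bprob_le_one h0 h1 _
  | succ N ihN =>
    refine main (N + 1) (fun R s a hs hsz => ?_) d
    have := ihN m ∅ R s a (by simp) .empty (by simp) (by simp)
      (fun i hi k hk hik u hu v hv huR _ hvR _ => hs i hi k hk hik u hu v hv huR hvR) (by simp)
      (fun k hk => by have := hsz k hk; rw [Nat.succ_mul] at this; omega)
    rw [pow_succ, mul_comm]
    simpa using this

/-- Repeated attempts to grow a set of `m` vertices through the layers `L 0, L 1, …` fail with
exponentially small probability in the number `N` of attempts. -/
theorem bprob_not_built_le [Fintype V] {r m : ℕ} {p : ℝ} (h0 : 0 ≤ p) (h1 : p ≤ 1)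
    {L : ℕ → Finset V} (hL : ∀ i j, i ≠ j → Disjoint (L i) (L j)) {sz : ℕ → ℕ} {q : ℕ → ℝ}
    (hq0 : ∀ k < m, 0 ≤ q k) (hq1 : ∀ k < m, q k ≤ 1)
    (hq : ∀ k < m, (1 - (k.choose (min k r) : ℝ) * (p ^ (min k r) * (1 - p) ^ (k - min k r))) ^ sz k
      ≤ 1 - q k) {N : ℕ} (hsz : ∀ k < m, sz k + N * m ≤ (L k).card) :
    bprob (allEdges V) p (fun ω => ¬ ∃ B : Finset V, B.card = m ∧ Built r ω B)
      ≤ (1 - ∏ k ∈ Finset.range m, q k) ^ N := by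
  have := bprob_not_built_le_aux h0 h1 hL hq0 hq1 hq N m ∅ ∅ (allEdges V) ∅ (by simp) .empty
    (by simp) (by simp) (fun i _ k _ hik u hu v hv _ _ _ _ => mem_allEdges.2 fun h =>
      Finset.disjoint_left.1 (hL i k hik) hu (h ▸ hv)) (by simp) (by simpa using hsz)
  simp only [Finset.empty_union, Finset.card_empty, ← Finset.range_eq_Ico] at this
  refine this.trans (mul_le_of_le_one_left (pow_nonneg (sub_nonneg.2 ?_) _) ?_)
  · exact Finset.prod_le_one (fun k hk => hq0 k (Finset.mem_range.1 hk))
      fun k hk => hq1 k (Finset.mem_range.1 hk)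
  · linarith [Finset.prod_nonneg fun k hk => hq0 k (Finset.mem_range.1 hk)]

/-- The point mass at r serves when the expected degree into `A` is bounded, the Chernoff bound when
it is large. -/
theorem bprob_starPairs_card_lt_le {p : ℝ} (h0 : 0 ≤ p) (h1 : p ≤ 1) (r : ℕ) (A : Finset V) (v : V) :
    bprob (starPairs A v) p (fun ω => ω.card < r) ≤
      min (1 - (A.card.choose r : ℝ) * (p ^ r * (1 - p) ^ (A.card - r)))
        (2 ^ r * (1 - p / 2) ^ A.card) := by
  refine le_min ?_ ?_
  · have h2 := bprob_not (starPairs A v) p (fun ω => r ≤ ω.card)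
    have h3 := le_bprob_card (s := starPairs A v) h0 h1 r
    simp only [not_le] at h2
    rw [card_starPairs] at h3
    linarith
  · have := bprob_card_le_le (subset_refl (starPairs A v)) h0 h1 r
    rw [card_starPairs] at this
    refine (bprob_mono h0 h1 fun ω hω h => ?_).trans this
    rw [Finset.inter_eq_left.2 hω]
    exact h.le

end Growth

/-! ### Expansion of large sets. -/

section Expansion

variable {V : Type*} [Fintype V] [DecidableEq V]

/-- Every proper set of at least `m` vertices has an outside vertex with at least `r` neighbours
in the set. -/
def Expanding (r m : ℕ) (ω : Finset (Sym2 V)) : Prop :=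
  ∀ A : Finset V, m ≤ A.card → A ≠ Finset.univ → ∃ v ∉ A, r ≤ (nbrsIn ω A v).card

theorem Expanding.mono {r m : ℕ} {ω ω' : Finset (Sym2 V)} (hω : ω ⊆ ω') (h : Expanding r m ω) :
    Expanding r m ω' := fun A hA hne =>
  let ⟨v, hv, hr⟩ := h A hA hne
  ⟨v, hv, hr.trans (Finset.card_le_card (nbrsIn_mono hω A v))⟩

theorem Expanding.eq_univ {r m : ℕ} {ω : Finset (Sym2 V)} (h : Expanding r m ω) {Z : Set V}
    (hZ : PercClosed (edgeGraph ω) r Z) {B : Finset V} (hB : m ≤ B.card) (hBZ : ↑B ⊆ Z) :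
    Z = Set.univ := by
  classical
  set A : Finset V := Finset.univ.filter (· ∈ Z) with hA
  have hAZ : (A : Set V) = Z := by ext; simp [hA]
  by_contra hne
  obtain ⟨v, hv, hr⟩ := h A (hB.trans (Finset.card_le_card fun u hu => by simp [hA, hBZ hu]))
    (fun h => hne (by rw [← hAZ, h, Finset.coe_univ]))
  have := hZ v (manyNbrs_edgeGraph hv hr hAZ.le)
  exact hv (by simp [hA, this])

/-- Start from m vertices containing `U` and add vertices one by one by expansion. Each has r
neighbours in the current set, fewer than r of them in `U`, so it brings a new edge avoiding `U`. -/
theorem Expanding.le_ncard_inside {r m : ℕ} {ω : Finset (Sym2 V)} (h : Expanding r m ω)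
    {U : Finset V} (hU : U.card < r) (hrm : r ≤ m) (hm : m ≤ Fintype.card V) :
    Fintype.card V - m ≤ (inside (edgeGraph ω) (U : Set V)ᶜ).ncard := by
  have key : ∀ j ≤ Fintype.card V - m, ∃ A : Finset V, U ⊆ A ∧ A.card = m + j ∧
      j ≤ (inside (edgeGraph ω) ((A \ U : Finset V) : Set V)).ncard := by
    intro j
    induction j with
    | zero =>
      intro _
      obtain ⟨A, hUA, -, hA⟩ := Finset.exists_subsuperset_card_eq (Finset.subset_univ U)
        (show U.card ≤ m by omega) (by simpa using hm)
      exact ⟨A, hUA, hA, Nat.zero_le _⟩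
    | succ j ih =>
      intro hj
      obtain ⟨A, hUA, hA, hin⟩ := ih (by omega)
      obtain ⟨v, hv, hr⟩ := h A (by omega) (fun h => by
        rw [h, Finset.card_univ] at hA
        omega)
      obtain ⟨u, hu, huU⟩ : ∃ u ∈ nbrsIn ω A v, u ∉ U := by
        by_contra! hcon
        have := Finset.card_le_card (s := nbrsIn ω A v) (t := U) hcon
        omega
      rw [mem_nbrsIn] at hu
      have hvU : v ∉ U := fun h => hv (hUA h)
      have hv' : v ∉ A \ U := fun h => hv (Finset.mem_sdiff.1 h).1
      have hadd := ncard_inside_cons (G := edgeGraph ω) hv' (T := {u}) fun w hw => by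
        obtain rfl := Finset.mem_singleton.1 hw
        refine ⟨Finset.mem_sdiff.2 ⟨hu.1, huU⟩, ?_⟩
        rw [SimpleGraph.fromEdgeSet_adj, Sym2.eq_swap]
        exact ⟨hu.2, fun h => hv (h ▸ hu.1)⟩
      refine ⟨Finset.cons v A hv, hUA.trans (Finset.subset_cons hv), ?_, ?_⟩
      · rw [Finset.card_cons]
        omega
      · have : Finset.cons v A hv \ U = Finset.cons v (A \ U) hv' := by
          rw [Finset.cons_eq_insert, Finset.cons_eq_insert, Finset.insert_sdiff_of_notMem _ hvU]
        rw [this]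
        rw [Finset.card_singleton] at hadd
        omega
  obtain ⟨A, -, -, hA⟩ := key _ le_rfl
  refine hA.trans (Set.ncard_le_ncard ?_ (Set.toFinite _))
  rintro e ⟨he, hx⟩
  exact ⟨he, fun x hxe => (Finset.mem_sdiff.1 (hx x hxe)).2⟩

theorem wsat_star_eq_of_built {t m : ℕ} (ht : 1 ≤ t) {ω : Finset (Sym2 V)} (htm : t ≤ m)
    (hm : m + t.choose 2 < Fintype.card V) (hE : Expanding (t - 1) m ω) {B : Finset V}
    (hB : B.card = m) (hbuilt : Built (t - 1) ω B) :
    wsat (edgeGraph ω) (starGraphK t) = t.choose 2 := by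
  refine le_antisymm ?_ (choose_two_le_wsat_star ht fun U hU => ?_)
  · obtain ⟨S, hS, hcl, hZ⟩ := hbuilt.exists_clique (by omega)
    refine wsat_star_le_choose_two ht hS hcl (fun v hv => ?_)
      fun Z hSZ hclosed => hE.eq_univ hclosed hB.ge (hZ Z hSZ hclosed)
    -- Only `v` lies outside this set, so expansion says that `v` has degree at least t - 1; at most
    -- t - 2 of these neighbours are in the clique.
    obtain ⟨v', hv', hr⟩ := hE (Finset.univ.erase v)
      (by rw [Finset.card_erase_of_mem (Finset.mem_univ _), Finset.card_univ]; omega)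
      (fun h => Finset.notMem_erase v Finset.univ (by rw [h]; exact Finset.mem_univ v))
    obtain rfl : v' = v := by simpa using hv'
    obtain ⟨w, hw, hwS⟩ : ∃ w ∈ nbrsIn ω (Finset.univ.erase v') v', w ∉ S.erase v' := by
      by_contra! hcon
      have h1 := Finset.card_le_card (s := nbrsIn ω (Finset.univ.erase v') v') (t := S.erase v') hcon
      have h2 := Finset.card_pos.2 ⟨v', hv⟩
      rw [Finset.card_erase_of_mem hv] at h1
      omega
    rw [mem_nbrsIn, Finset.mem_erase] at hw
    refine ⟨w, fun h => hwS (Finset.mem_erase.2 ⟨hw.1.1, h⟩), ?_⟩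
    rw [SimpleGraph.fromEdgeSet_adj, Sym2.eq_swap]
    exact ⟨hw.2, hw.1.1.symm⟩
  · refine le_trans ?_ (hE.le_ncard_inside hU (by omega) (by omega))
    exact (Nat.choose_le_choose 2 (Nat.sub_le _ _)).trans (by omega)

theorem bprob_not_expanding_le {r m : ℕ} {p ε : ℝ} (h0 : 0 ≤ p) (h1 : p ≤ 1) {x : ℕ → ℝ}
    (hx : ∀ (A : Finset V) (v : V), bprob (starPairs A v) p (fun ω => ω.card < r) ≤ x A.card)
    (hε0 : 0 ≤ ε)
    (hε : ∀ a, m ≤ a → a < Fintype.card V →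
      ((Fintype.card V).choose a : ℝ) * x a ^ (Fintype.card V - a) ≤ ε) :
    bprob (allEdges V) p (fun ω => ¬ Expanding r m ω) ≤ (Fintype.card V + 1) * ε := by
  set n := Fintype.card V with hn
  have hbad : ∀ A : Finset V,
      bprob (allEdges V) p (fun ω => ∀ v ∈ Aᶜ, (nbrsIn ω A v).card < r) ≤ x A.card ^ (n - A.card) := by
    intro A
    have hdis : Disjoint A Aᶜ := disjoint_compl_right
    have hsub : crossPairs A Aᶜ ⊆ allEdges V := by
      intro e he
      obtain ⟨u, hu, v, hv, rfl⟩ := mem_crossPairs.1 he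
      exact mem_allEdges.2 fun h => Finset.mem_compl.1 hv (h ▸ hu)
    have := bprob_forall_card_nbrsIn_lt hdis h0 h1 r fun v _ => hx A v
    rw [Finset.card_compl, ← hn] at this
    refine le_trans (le_of_eq ?_) this
    unfold bprob
    rw [← bexp_inter hsub]
    refine bexp_congr fun ω _ => ?_
    have : ∀ v ∈ Aᶜ, nbrsIn (ω ∩ crossPairs A Aᶜ) A v = nbrsIn ω A v := by
      intro v hv
      ext u
      simp only [mem_nbrsIn, Finset.mem_inter]
      refine ⟨fun h => ⟨h.1, h.2.1⟩, fun h => ⟨h.1, h.2, ?_⟩⟩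
      exact mk_mem_crossPairs.2 (Or.inl ⟨h.1, hv⟩)
    have hiff : (∀ v ∈ Aᶜ, (nbrsIn ω A v).card < r) ↔
        ∀ v ∈ Aᶜ, (nbrsIn (ω ∩ crossPairs A Aᶜ) A v).card < r :=
      forall₂_congr fun v hv => by rw [this v hv]
    by_cases h : ∀ v ∈ Aᶜ, (nbrsIn ω A v).card < r
    · rw [if_pos h, if_pos (hiff.1 h)]
    · rw [if_neg h, if_neg (mt hiff.2 h)]
  let 𝒜 : Finset (Finset V) := Finset.univ.filter fun A => m ≤ A.card ∧ A ≠ Finset.univ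
  calc bprob (allEdges V) p (fun ω => ¬ Expanding r m ω)
      ≤ bprob (allEdges V) p (fun ω => ∃ A ∈ 𝒜, ∀ v ∈ Aᶜ, (nbrsIn ω A v).card < r) := by
        refine bprob_mono h0 h1 fun ω _ h => ?_
        unfold Expanding at h
        push Not at h
        obtain ⟨A, hA, hne, h⟩ := h
        exact ⟨A, by simp [𝒜, hA, hne], fun v hv => h v (Finset.mem_compl.1 hv)⟩
    _ ≤ ∑ A ∈ 𝒜, x A.card ^ (n - A.card) :=
        (bprob_exists_le h0 h1 _ _).trans (Finset.sum_le_sum fun A _ => hbad A)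
    -- Spreading ε evenly over the sets of each size makes every size contribute ε, and there are n
    -- + 1 sizes.
    _ ≤ ∑ A ∈ 𝒜, ε / (n.choose A.card : ℝ) := by
        refine Finset.sum_le_sum fun A hA => ?_
        simp only [𝒜, Finset.mem_filter, Finset.mem_univ, true_and] at hA
        have hlt : A.card < n := (Finset.card_lt_iff_ne_univ A).2 hA.2
        have hpos : (0 : ℝ) < n.choose A.card := by exact_mod_cast Nat.choose_pos hlt.le
        rw [le_div_iff₀ hpos, mul_comm]
        exact hε _ hA.1 hlt
    _ ≤ ∑ A ∈ (Finset.univ : Finset V).powerset, ε / (n.choose A.card : ℝ) :=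
        Finset.sum_le_sum_of_subset_of_nonneg (fun A _ => by simp) fun A _ _ => by positivity
    _ = (n + 1) * ε := by
        rw [Finset.sum_powerset_apply_card (fun k => ε / (n.choose k : ℝ)), Finset.card_univ, ← hn,
          Finset.sum_congr rfl (g := fun _ => ε), Finset.sum_const, Finset.card_range, nsmul_eq_mul]
        · push_cast; ring
        · intro k hk
          have hpos : (0 : ℝ) < n.choose k := by
            exact_mod_cast Nat.choose_pos (Nat.lt_succ_iff.1 (Finset.mem_range.1 hk))
          rw [nsmul_eq_mul]
          field_simp

end Expansion

/-! ### Numerical estimates for expansion. -/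

section Estimates

theorem pow_le_mul_choose {r k : ℕ} (hr : 1 ≤ r) (hk : r ≤ k) :
    (k : ℝ) ^ r ≤ (r : ℝ) ^ r * r.factorial * k.choose r := by
  have h1 := Nat.pow_le_choose (α := ℝ) r k
  have hf : (0 : ℝ) < r.factorial := by exact_mod_cast r.factorial_pos
  rw [div_le_iff₀ hf] at h1
  have h2 : k ≤ r * (k + 1 - r) := by
    obtain ⟨j, rfl⟩ := Nat.exists_eq_add_of_le hk
    rw [show r + j + 1 - r = j + 1 by omega]
    nlinarith
  have h3 : (k : ℝ) ^ r ≤ (r : ℝ) ^ r * ((k + 1 - r : ℕ) : ℝ) ^ r := by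
    rw [← mul_pow]
    exact pow_le_pow_left₀ (by positivity) (by exact_mod_cast h2) r
  refine h3.trans ?_
  rw [mul_assoc]
  refine mul_le_mul_of_nonneg_left ?_ (by positivity)
  rw [mul_comm]
  exact h1

theorem exp_neg_two_mul_le_one_sub {p : ℝ} (h0 : 0 ≤ p) (h1 : p ≤ 1 / 2) :
    Real.exp (-(2 * p)) ≤ 1 - p := by
  rw [Real.exp_neg, inv_le_comm₀ (Real.exp_pos _) (by linarith)]
  refine le_trans ?_ (Real.add_one_le_exp (2 * p))
  rw [inv_le_iff_one_le_mul₀ (by linarith)]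
  nlinarith

theorem one_sub_pow_le_exp {x : ℝ} (hx : x ≤ 1) (k : ℕ) : (1 - x) ^ k ≤ Real.exp (-(k * x)) := by
  rw [show -(k * x) = k * (-x) by ring, Real.exp_nat_mul]
  exact pow_le_pow_left₀ (by linarith) (Real.one_sub_le_exp_neg x) k

/-- The probability that a binomial variable takes the value `r`, for bounded expectation. -/
theorem le_choose_mul_pow {r k : ℕ} (hr : 1 ≤ r) (hk : r ≤ k) {p : ℝ} (h0 : 0 ≤ p)
    (h1 : p ≤ 1 / 2) :
    (k * p) ^ r * Real.exp (-(2 * (k * p))) / ((r : ℝ) ^ r * r.factorial)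
      ≤ (k.choose r : ℝ) * (p ^ r * (1 - p) ^ (k - r)) := by
  have hf : (0 : ℝ) < r.factorial := by exact_mod_cast r.factorial_pos
  have hr' : (0 : ℝ) < r := by exact_mod_cast hr
  rw [div_le_iff₀ (by positivity)]
  have h2 : Real.exp (-(2 * (k * p))) ≤ (1 - p) ^ (k - r) := by
    rw [show -(2 * (k * p)) = k * (-(2 * p)) by ring, Real.exp_nat_mul]
    refine (pow_le_pow_left₀ (Real.exp_pos _).le (exp_neg_two_mul_le_one_sub h0 h1) k).trans ?_
    exact pow_le_pow_of_le_one (by linarith) (by linarith) (Nat.sub_le _ _)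
  have h3 := pow_le_mul_choose hr hk
  calc (k * p) ^ r * Real.exp (-(2 * (k * p)))
      ≤ ((r : ℝ) ^ r * r.factorial * k.choose r * p ^ r) * (1 - p) ^ (k - r) := by
        rw [mul_pow]
        gcongr
    _ = _ := by ring

theorem choose_le_exp {n a : ℕ} (hn : 1 ≤ n) :
    (n.choose a : ℝ) ≤ Real.exp (a * Real.log n) := by
  rw [Real.exp_nat_mul, Real.exp_log (by exact_mod_cast hn)]
  exact_mod_cast Nat.choose_le_pow n a

/-- Three ranges of a. For a at least n/(8u), choosing the complement costs only u per missing
vertex, and Chernoff gives an exponent of at least 3u for each of them. For smaller a with a p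
bounded below, a u is at most n/8 while Chernoff gives at least 1 per outside vertex. For a p
bounded, the point mass at r is used. -/
theorem bprob_not_expanding_le_of_pow_eq {n r m : ℕ} (hr : 2 ≤ r) {p u C : ℝ} (hu : u = Real.log n)
    (hu2 : 2 ≤ u) (hp0 : 0 < p) (hp : p ≤ 1 / 2) (hpn : n * p ^ r * u ^ (r - 1) = C ^ r)
    (hC : 4 * Real.exp (4 * (r + 1)) * ((r : ℝ) ^ r * r.factorial) ≤ C ^ r)
    (hm : u ^ 2 ≤ m) (hrm : r ≤ m) (h16 : 16 * u * (3 * u + r) ≤ n * p)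
    (hn4 : 16 * u ≤ n) :
    bprob (allEdges (Fin n)) p (fun ω => ¬ Expanding r m ω) ≤ (n + 1) * Real.exp (-(2 * u)) := by
  have hn1 : 1 ≤ n := by
    by_contra h
    obtain rfl : n = 0 := by omega
    simp at hu
    linarith
  have hnR : (0 : ℝ) < n := by exact_mod_cast hn1
  have hr' : (2 : ℝ) ≤ r := by exact_mod_cast hr
  have key := bprob_not_expanding_le (V := Fin n) (r := r) (m := m) hp0.le (by linarith : p ≤ 1)
    -- Truncation at 0 keeps the base nonnegative, so upper bounds on it may be raised to powers.
    (x := fun a => max 0 (min (1 - (a.choose r : ℝ) * (p ^ r * (1 - p) ^ (a - r)))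
        (2 ^ r * (1 - p / 2) ^ a)))
    (ε := Real.exp (-(2 * u)))
    (fun A v => (bprob_starPairs_card_lt_le hp0.le (by linarith) r A v).trans (le_max_right _ _))
    (Real.exp_pos _).le
  rw [Fintype.card_fin] at key
  refine key fun a ham han => ?_
  set X := max 0 (min (1 - (a.choose r : ℝ) * (p ^ r * (1 - p) ^ (a - r)))
        (2 ^ r * (1 - p / 2) ^ a)) with hX
  have hX0 : 0 ≤ X := le_max_left _ _
  have haR : (a : ℝ) < n := by exact_mod_cast han
  have hna : ((n - a : ℕ) : ℝ) = n - a := by rw [Nat.cast_sub han.le]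
  have hchoose : (n.choose a : ℝ) ≤ Real.exp (a * u) := by rw [hu]; exact choose_le_exp hn1
  have hchoose' : (n.choose a : ℝ) ≤ Real.exp ((n - a) * u) := by
    rw [hu, ← hna, ← Nat.choose_symm han.le]
    exact choose_le_exp hn1
  have hua : u ^ 2 ≤ a := hm.trans (by exact_mod_cast ham)
  have ha2 : (2 : ℝ) ≤ a := by nlinarith
  have hra : r ≤ a := hrm.trans ham
  -- a bound `X ≤ exp (-y)` turns into a bound on the summand
  have hfin : ∀ y z : ℝ, X ≤ Real.exp (-y) → (n.choose a : ℝ) ≤ Real.exp z →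
      z + 2 * u ≤ (n - a) * y → (n.choose a : ℝ) * X ^ (n - a) ≤ Real.exp (-(2 * u)) := by
    intro y z hy hz hle
    calc (n.choose a : ℝ) * X ^ (n - a)
        ≤ Real.exp z * Real.exp (-y) ^ (n - a) :=
          mul_le_mul hz (pow_le_pow_left₀ hX0 hy _) (pow_nonneg hX0 _) (Real.exp_pos _).le
      _ = Real.exp (z + (n - a) * (-y)) := by rw [← Real.exp_nat_mul, hna, ← Real.exp_add]
      _ ≤ _ := Real.exp_le_exp.2 (by linarith)
  have hX2 : X ≤ Real.exp (-(a * p / 2 - r)) := by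
    refine max_le (Real.exp_pos _).le ((min_le_right _ _).trans ?_)
    have h1 := one_sub_pow_le_exp (x := p / 2) (by linarith) a
    have h2 : (2 : ℝ) ^ r ≤ Real.exp r := by
      rw [← Real.exp_one_pow]
      refine pow_le_pow_left₀ (by norm_num) ?_ r
      linarith [Real.add_one_le_exp 1]
    calc (2 : ℝ) ^ r * (1 - p / 2) ^ a ≤ Real.exp r * Real.exp (-(a * (p / 2))) :=
          mul_le_mul h2 h1 (pow_nonneg (by linarith) _) (Real.exp_pos _).le
      _ = _ := by rw [← Real.exp_add]; ring_nf
  rcases le_or_gt (n : ℝ) (8 * u * a) with hbig | hsmall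
  · -- almost spanning sets
    refine hfin _ _ hX2 hchoose' ?_
    have hge : 1 ≤ (n : ℝ) - a := by
      rw [← hna]
      exact_mod_cast (by omega : 1 ≤ n - a)
    have h1 : 2 * (3 * u + r) * (8 * u) ≤ a * p * (8 * u) := by nlinarith
    have h2 : 2 * (3 * u + r) ≤ a * p := le_of_mul_le_mul_right h1 (by linarith)
    nlinarith
  · have hhalf : (n : ℝ) / 2 ≤ n - a := by nlinarith
    have hau : (a : ℝ) * u ≤ n / 8 := by linarith
    rcases le_or_gt (2 * ((r : ℝ) + 1)) (a * p) with hmid | hlow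
    · refine hfin _ _ hX2 hchoose ?_
      nlinarith
    · set B := (r : ℝ) ^ r * r.factorial with hB
      have hBpos : 0 < B := by
        have : (0 : ℝ) < r.factorial := by exact_mod_cast r.factorial_pos
        positivity
      have hπ := le_choose_mul_pow (by omega) hra hp0.le hp
      rw [← hB] at hπ
      set y := (a * p) ^ r * Real.exp (-(2 * (a * p))) / B with hy
      have hXy : X ≤ Real.exp (-y) := by
        refine max_le (Real.exp_pos _).le ((min_le_left _ _).trans ?_)
        exact le_trans (by linarith) (Real.one_sub_le_exp_neg y)
      refine hfin y _ hXy hchoose ?_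
      have hy0 : 0 ≤ y := by positivity
      have hmain : 4 * (a * u) ≤ n * y := by
        have he : Real.exp (-(4 * ((r : ℝ) + 1))) ≤ Real.exp (-(2 * (a * p))) :=
          Real.exp_le_exp.2 (by linarith)
        have hupos : (0 : ℝ) < u ^ (r - 1) := by positivity
        -- Here a ≥ u^2 and r ≥ 2 enter: n (a p)^r = C^r a (a/u)^(r-1) is then at least C^r a u,
        -- which beats the entropy a u.
        have hpow : u ^ r ≤ (a : ℝ) ^ (r - 1) := by
          calc u ^ r ≤ u ^ (2 * (r - 1)) := pow_le_pow_right₀ (by linarith) (by omega)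
            _ = (u ^ 2) ^ (r - 1) := by rw [pow_mul]
            _ ≤ _ := pow_le_pow_left₀ (by positivity) hua _
        rw [hy, ← mul_div_assoc, le_div_iff₀ hBpos]
        refine le_of_mul_le_mul_right ?_ hupos
        have e1 : (a : ℝ) ^ r = a ^ (r - 1) * a := by rw [← pow_succ]; congr 1; omega
        have e2 : u ^ r = u ^ (r - 1) * u := by rw [← pow_succ]; congr 1; omega
        have hC' : 4 * B ≤ C ^ r * Real.exp (-(4 * ((r : ℝ) + 1))) := by
          rw [Real.exp_neg, ← div_eq_mul_inv, le_div_iff₀ (Real.exp_pos _)]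
          linarith
        calc 4 * (a * u) * B * u ^ (r - 1) = (4 * B) * a * u ^ r := by rw [e2]; ring
          _ ≤ (C ^ r * Real.exp (-(4 * ((r : ℝ) + 1)))) * a * (a : ℝ) ^ (r - 1) := by
              refine mul_le_mul (mul_le_mul_of_nonneg_right hC' (by linarith)) hpow (by positivity) ?_
              rw [← hpn]
              positivity
          _ = C ^ r * (a : ℝ) ^ r * Real.exp (-(4 * ((r : ℝ) + 1))) := by rw [e1]; ring
          _ ≤ C ^ r * (a : ℝ) ^ r * Real.exp (-(2 * (a * p))) := by
              refine mul_le_mul_of_nonneg_left he ?_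
              rw [← hpn]
              positivity
          _ = n * ((a * p) ^ r * Real.exp (-(2 * (a * p)))) * u ^ (r - 1) := by
              rw [← hpn, mul_pow]; ring
      have h1 := mul_le_mul_of_nonneg_right hhalf hy0
      have h2 := mul_le_mul_of_nonneg_right ha2 (by linarith : 0 ≤ u)
      linarith

end Estimates

/-! ### Layer sizes and success probabilities for the growth. -/

section GrowthEstimates

theorem exists_disjoint_layers {n m : ℕ} (d : ℕ → ℕ) (hd : ∑ k ∈ Finset.range m, d k ≤ n) :
    ∃ L : ℕ → Finset (Fin n), (∀ i j, i ≠ j → Disjoint (L i) (L j)) ∧ ∀ k < m, (L k).card = d k := by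
  let D : ℕ → ℕ := fun k => ∑ i ∈ Finset.range k, d i
  have hD : Monotone D := fun a b hab =>
    Finset.sum_le_sum_of_subset (Finset.range_mono hab)
  have hDs : ∀ k, D (k + 1) = D k + d k := fun k => Finset.sum_range_succ _ _
  refine ⟨fun k => Finset.univ.filter fun i : Fin n => D k ≤ i ∧ (i : ℕ) < D (k + 1), ?_, ?_⟩
  · have hlt : ∀ i j, i < j → Disjoint
        (Finset.univ.filter fun x : Fin n => D i ≤ x ∧ (x : ℕ) < D (i + 1))
        (Finset.univ.filter fun x : Fin n => D j ≤ x ∧ (x : ℕ) < D (j + 1)) := by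
      intro i j hij
      rw [Finset.disjoint_left]
      intro x hx hx'
      simp only [Finset.mem_filter, Finset.mem_univ, true_and] at hx hx'
      have := hD (Nat.succ_le_of_lt hij)
      simp only [Nat.succ_eq_add_one] at this
      omega
    intro i j hij
    rcases hij.lt_or_gt with h | h
    · exact hlt i j h
    · exact (hlt j i h).symm
  · intro k hk
    have hkn : D (k + 1) ≤ n := (hD (Nat.succ_le_of_lt hk)).trans hd
    have : (Finset.univ.filter fun i : Fin n => D k ≤ i ∧ (i : ℕ) < D (k + 1)).map
        Fin.valEmbedding = Finset.Ico (D k) (D (k + 1)) := by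
      ext x
      simp only [Finset.mem_map, Finset.mem_filter, Finset.mem_univ, true_and,
        Fin.valEmbedding_apply, Finset.mem_Ico]
      constructor
      · rintro ⟨y, hy, rfl⟩
        exact hy
      · intro hx
        exact ⟨⟨x, by omega⟩, hx, rfl⟩
    rw [← Finset.card_map Fin.valEmbedding, this, Nat.card_Ico, hDs]
    omega

/-- The proportion of the vertices that is reserved for the layer `k`. -/
noncomputable def layerWeight (l k : ℕ) : ℝ :=
  √l / 4 * (1 / √(k + l) - 1 / √(k + 1 + l))

/-- The weights telescope. They decay like √l (k+l)^(-3/2): summable, yet slower than the growth k^r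
of the chance of being a candidate, since r ≥ 2. -/
theorem sum_layerWeight_le (l m : ℕ) (hl : 1 ≤ l) :
    ∑ k ∈ Finset.range m, layerWeight l k ≤ 1 / 4 := by
  have hl' : (0 : ℝ) < √l := Real.sqrt_pos.2 (by exact_mod_cast hl)
  have h := Finset.sum_range_sub' (fun k : ℕ => 1 / √((k : ℝ) + l)) m
  simp only [layerWeight]
  rw [← Finset.mul_sum]
  push_cast at h
  rw [h, zero_add]
  have h2 : 0 ≤ 1 / √((m : ℝ) + l) := by positivity
  calc √l / 4 * (1 / √l - 1 / √((m : ℝ) + l)) ≤ √l / 4 * (1 / √l) := by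
        gcongr
        linarith
    _ = 1 / 4 := by field_simp

/-- With a and b the two roots, b^2 - a^2 = 1 gives 1/a - 1/b = 1/(ab(a+b)). `M` stands for the
order of magnitude of k + l: it is taken to be l when k < l and k when k ≥ l. -/
theorem le_layerWeight {l k M : ℕ} (hl : 1 ≤ l) (hM : k + l + 1 ≤ 3 * M) :
    √l / (48 * (M * √M)) ≤ layerWeight l k := by
  have hk0 : (0 : ℝ) < k + l := by
    have : (1 : ℝ) ≤ l := by exact_mod_cast hl
    positivity
  have hMR : (k : ℝ) + 1 + l ≤ 3 * M := by exact_mod_cast (by omega : k + 1 + l ≤ 3 * M)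
  have hM0 : (0 : ℝ) < M := by linarith
  have ha : 0 < √((k : ℝ) + l) := Real.sqrt_pos.2 hk0
  have hab : √((k : ℝ) + l) ≤ √((k : ℝ) + 1 + l) := Real.sqrt_le_sqrt (by linarith)
  have ha2 := Real.sq_sqrt hk0.le
  have hb2 := Real.sq_sqrt (by linarith : (0 : ℝ) ≤ k + 1 + l)
  have hbM : √((k : ℝ) + 1 + l) ≤ 2 * √M := by
    rw [Real.sqrt_le_left (by positivity), mul_pow, Real.sq_sqrt hM0.le]
    linarith
  rw [layerWeight]
  set a := √((k : ℝ) + l)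
  set b := √((k : ℝ) + 1 + l)
  have hb : 0 < b := ha.trans_le hab
  have hs : 0 < √(M : ℝ) := Real.sqrt_pos.2 hM0
  have h1 : 1 / a - 1 / b = 1 / (a * b * (a + b)) := by
    have : (b - a) * (a + b) = 1 := by nlinarith
    field_simp
    linarith
  have h2 : a * b * (a + b) ≤ 12 * (M * √M) := by
    calc a * b * (a + b) ≤ b * b * (b + b) := by gcongr
      _ = 2 * b ^ 2 * b := by ring
      _ ≤ 2 * (3 * M) * (2 * √M) := by
          rw [hb2]
          gcongr
      _ = 12 * (M * √M) := by ring
  rw [h1]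
  calc √l / (48 * (M * √M)) = √l / 4 * (1 / (12 * (M * √M))) := by field_simp; norm_num
    _ ≤ _ := by gcongr

/-- The success probability that is guaranteed for the layer `k`. -/
noncomputable def layerProb (r l k : ℕ) : ℝ :=
  if k < l then ((k + 1 : ℝ) / (2 * l)) ^ r / 8 else 1 - (l / k : ℝ) ^ 2 / 2

theorem layerProb_nonneg (r l k : ℕ) : 0 ≤ layerProb r l k := by
  rw [layerProb]
  split_ifs with h
  · positivity
  · push Not at h
    have h1 : (l / k : ℝ) ≤ 1 := div_le_one_of_le₀ (by exact_mod_cast h) (by positivity)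
    have h2 : (0 : ℝ) ≤ l / k := by positivity
    nlinarith

theorem layerProb_le_one (r l k : ℕ) : layerProb r l k ≤ 1 := by
  rw [layerProb]
  split_ifs with h
  · have h1 : (k + 1 : ℝ) ≤ l := by exact_mod_cast h
    have h0 : (0 : ℝ) ≤ k := by positivity
    have h2 : (k + 1 : ℝ) / (2 * l) ≤ 1 := div_le_one_of_le₀ (by linarith) (by positivity)
    have := pow_le_one₀ (n := r) (by positivity) h2
    linarith
  · have : (0 : ℝ) ≤ (l / k : ℝ) ^ 2 := by positivity
    linarith

/-- Layers below l contribute (l!/(2l)^l)^r / 8^l, at least exp(-(2r+3) l). Layers from l on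
contribute at least exp(-∑ (l/k)^2), where the sum is at most 2l. -/
theorem le_prod_layerProb {r l m : ℕ} (hl : 1 ≤ l) (hlm : l ≤ m) :
    Real.exp (-((2 * r + 5) * l)) ≤ ∏ k ∈ Finset.range m, layerProb r l k := by
  have hlR : (1 : ℝ) ≤ l := by exact_mod_cast hl
  rw [← Finset.prod_range_mul_prod_Ico _ hlm]
  have h1 : Real.exp (-((2 * r + 3) * l)) ≤ ∏ k ∈ Finset.range l, layerProb r l k := by
    have e1 : ∏ k ∈ Finset.range l, layerProb r l k
        = ((l.factorial : ℝ) / (2 * l) ^ l) ^ r / 8 ^ l := by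
      rw [Finset.prod_congr rfl (g := fun k : ℕ => ((k + 1 : ℝ) / (2 * l)) ^ r / 8) fun k hk => by
        rw [layerProb, if_pos (Finset.mem_range.1 hk)]]
      rw [Finset.prod_div_distrib, Finset.prod_pow, Finset.prod_div_distrib, Finset.prod_const,
        Finset.prod_const, Finset.card_range, ← Finset.prod_range_add_one_eq_factorial]
      push_cast
      rfl
    rw [e1]
    have hf : (0 : ℝ) < l.factorial := by exact_mod_cast l.factorial_pos
    have hexp := Real.pow_div_factorial_le_exp l (by linarith : (0 : ℝ) ≤ l) l
    rw [div_le_iff₀ hf] at hexp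
    have h2e : (2 : ℝ) ≤ Real.exp 1 := by linarith [Real.add_one_le_exp 1]
    have e2 : Real.exp (-(2 * l)) ≤ (l.factorial : ℝ) / (2 * l) ^ l := by
      rw [le_div_iff₀ (by positivity), mul_pow]
      have h2l : (2 : ℝ) ^ l ≤ Real.exp l := by
        rw [← Real.exp_one_pow]
        exact pow_le_pow_left₀ (by norm_num) h2e l
      calc Real.exp (-(2 * l)) * (2 ^ l * (l : ℝ) ^ l)
          ≤ Real.exp (-(2 * l)) * (Real.exp l * (Real.exp l * l.factorial)) := by gcongr
        _ = (Real.exp (-(2 * l)) * Real.exp l * Real.exp l) * l.factorial := by ring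
        _ = l.factorial := by
          rw [← Real.exp_add, ← Real.exp_add]
          ring_nf
          simp
    have e3 : (8 : ℝ) ^ l ≤ Real.exp (3 * l) := by
      rw [mul_comm, Real.exp_nat_mul]
      refine pow_le_pow_left₀ (by norm_num) ?_ l
      have : Real.exp 3 = Real.exp 1 ^ 3 := by rw [← Real.exp_nat_mul]; norm_num
      rw [this]
      calc (8 : ℝ) = 2 ^ 3 := by norm_num
        _ ≤ _ := pow_le_pow_left₀ (by norm_num) h2e 3
    calc Real.exp (-((2 * r + 3) * l)) = Real.exp (-(2 * l)) ^ r / Real.exp (3 * l) := by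
          rw [← Real.exp_nat_mul, ← Real.exp_sub]
          ring_nf
      _ ≤ _ := by gcongr
  have h2 : Real.exp (-(2 * l)) ≤ ∏ k ∈ Finset.Ico l m, layerProb r l k := by
    have hpt : ∀ k ∈ Finset.Ico l m, Real.exp (-((l : ℝ) ^ 2 * ((k : ℝ) ^ 2)⁻¹)) ≤ layerProb r l k := by
      intro k hk
      have hlk := (Finset.mem_Ico.1 hk).1
      rw [layerProb, if_neg (by omega), ← div_eq_mul_inv, ← div_pow]
      have h1 : (l / k : ℝ) ≤ 1 := div_le_one_of_le₀ (by exact_mod_cast hlk) (by positivity)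
      have h2 : (0 : ℝ) ≤ l / k := by positivity
      have := exp_neg_two_mul_le_one_sub (p := (l / k : ℝ) ^ 2 / 2) (by positivity) (by nlinarith)
      rwa [mul_div_cancel₀ _ (two_ne_zero)] at this
    refine le_trans ?_ (Finset.prod_le_prod (fun k _ => (Real.exp_pos _).le) hpt)
    rw [← Real.exp_sum, Finset.sum_neg_distrib, ← Finset.mul_sum]
    have hs := sum_Ioo_inv_sq_le (α := ℝ) (l - 1) m
    have hI : Finset.Ioo (l - 1) m = Finset.Ico l m := by
      ext x
      simp only [Finset.mem_Ioo, Finset.mem_Ico]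
      omega
    have hc : ((l - 1 : ℕ) : ℝ) + 1 = l := by
      rw [Nat.cast_sub hl]
      simp
    rw [hI, hc] at hs
    refine Real.exp_le_exp.2 (neg_le_neg ?_)
    calc (l : ℝ) ^ 2 * ∑ k ∈ Finset.Ico l m, ((k : ℝ) ^ 2)⁻¹ ≤ (l : ℝ) ^ 2 * (2 / l) := by gcongr
      _ = 2 * (l : ℝ) := by field_simp
  calc Real.exp (-((2 * r + 5) * l)) = Real.exp (-((2 * r + 3) * l)) * Real.exp (-(2 * l)) := by
        rw [← Real.exp_add]
        ring_nf
    _ ≤ _ := mul_le_mul h1 h2 (Real.exp_pos _).le ((Real.exp_pos _).le.trans h1)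

theorem choose_mul_pow_le_one (k d : ℕ) {p : ℝ} (h0 : 0 ≤ p) (h1 : p ≤ 1) :
    (k.choose d : ℝ) * (p ^ d * (1 - p) ^ (k - d)) ≤ 1 := by
  have := (le_bprob_card (s := Finset.range k) h0 h1 d).trans (bprob_le_one h0 h1 _)
  rwa [Finset.card_range] at this

/-- The layer fails with probability at most exp(-z), z being a lower bound for the expected number
of candidates: 1 for k < r by `hstart`, 8 (k/l)^r for r ≤ k < l, and 8 √(k/l) for k ≥ l. The
constant 1152 is 8 · 48 · 3, with 48 from the layer weight and 3 from exp(2kp) ≤ 3. -/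
theorem layer_bound {n r l m k : ℕ} (hr : 2 ≤ r) {p u x C : ℝ} (hu : 0 < u) (hx : 0 < x)
    (hrl : r ≤ l) (hxl : x * u ≤ l) (hp0 : 0 < p) (hmp : m * p ≤ 1 / 2) (hp : p ≤ 1 / 2)
    (hpn : n * p ^ r * u ^ (r - 1) = C ^ r)
    (hC : 1152 * ((r : ℝ) ^ r * r.factorial) ≤ C ^ r * x ^ (r - 1))
    (hstart : 48 * l ≤ n * p ^ (r - 1)) (hk : k < m) :
    (1 - (k.choose (min k r) : ℝ) * (p ^ (min k r) * (1 - p) ^ (k - min k r))) ^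
      ⌈n * layerWeight l k⌉₊ ≤ 1 - layerProb r l k := by
  have hl0 : (0 : ℝ) < l := by exact_mod_cast (by omega : 0 < l)
  have hsl : 0 < √(l : ℝ) := Real.sqrt_pos.2 hl0
  have hsl2 : √(l : ℝ) * √l = l := Real.mul_self_sqrt hl0.le
  have hred : ∀ y w z : ℝ, y ≤ (k.choose (min k r) : ℝ) * (p ^ (min k r) * (1 - p) ^ (k - min k r)) →
      0 ≤ y → w ≤ layerWeight l k → z ≤ n * w * y → 0 ≤ w → Real.exp (-z) ≤ 1 - layerProb r l k →
      (1 - (k.choose (min k r) : ℝ) * (p ^ (min k r) * (1 - p) ^ (k - min k r))) ^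
        ⌈n * layerWeight l k⌉₊ ≤ 1 - layerProb r l k := by
    intro y w z hy hy0 hw hz hw0 hle
    refine (one_sub_pow_le_exp (choose_mul_pow_le_one _ _ hp0.le (by linarith)) _).trans
      (le_trans (Real.exp_le_exp.2 (neg_le_neg ?_)) hle)
    calc z ≤ n * w * y := hz
      _ ≤ n * layerWeight l k * y := by gcongr
      _ ≤ ⌈n * layerWeight l k⌉₊ * y := by gcongr; exact Nat.le_ceil _
      _ ≤ _ := by gcongr
  rcases lt_or_ge k r with hkr | hkr
  · have hw := le_layerWeight (l := l) (k := k) (M := l) (by omega) (by omega)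
    have hw' : √(l : ℝ) / (48 * (l * √l)) = 1 / (48 * l) := by field_simp
    rw [hw'] at hw
    refine hred (p ^ (r - 1)) _ 1 ?_ (by positivity) hw ?_ (by positivity) ?_
    · rw [min_eq_left hkr.le, Nat.choose_self, Nat.sub_self]
      simpa using pow_le_pow_of_le_one hp0.le (by linarith) (by omega : k ≤ r - 1)
    · rw [mul_one_div, div_mul_eq_mul_div, le_div_iff₀ (by positivity)]
      linarith
    · rw [layerProb, if_pos (by omega)]
      have h1 : Real.exp (-1) ≤ 1 / 2 := by
        rw [Real.exp_neg, one_div]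
        exact inv_anti₀ (by norm_num) (by linarith [Real.add_one_le_exp 1])
      have h2 : (k + 1 : ℝ) / (2 * l) ≤ 1 := by
        refine div_le_one_of_le₀ ?_ (by positivity)
        have : (k + 1 : ℝ) ≤ l := by exact_mod_cast (by omega : k + 1 ≤ l)
        linarith
      have := pow_le_one₀ (n := r) (by positivity) h2
      linarith
  · set B := (r : ℝ) ^ r * r.factorial with hB
    have hBpos : 0 < B := by
      have : (0 : ℝ) < r.factorial := by exact_mod_cast r.factorial_pos
      have : (0 : ℝ) < r := by exact_mod_cast (by omega : 0 < r)
      positivity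
    have hk0 : (0 : ℝ) < k := by exact_mod_cast (by omega : 0 < k)
    have hkp : k * p ≤ 1 / 2 := by
      refine le_trans ?_ hmp
      have : (k : ℝ) ≤ m := by exact_mod_cast hk.le
      gcongr
    have hy : (k * p) ^ r / (3 * B) ≤
        (k.choose (min k r) : ℝ) * (p ^ (min k r) * (1 - p) ^ (k - min k r)) := by
      rw [min_eq_right hkr]
      refine le_trans ?_ (le_choose_mul_pow (by omega) hkr hp0.le hp)
      rw [← hB, ← div_div]
      gcongr
      rw [div_eq_mul_inv]
      gcongr
      rw [Real.exp_neg]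
      refine inv_anti₀ (Real.exp_pos _) ?_
      calc Real.exp (2 * (k * p)) ≤ Real.exp 1 := Real.exp_le_exp.2 (by linarith)
        _ ≤ 3 := by linarith [Real.exp_one_lt_d9]
    -- the expected number of candidates is large
    have hnp : 1152 * B ≤ n * p ^ r * (l : ℝ) ^ (r - 1) := by
      refine hC.trans ?_
      calc C ^ r * x ^ (r - 1) = n * p ^ r * (x * u) ^ (r - 1) := by rw [← hpn, mul_pow]; ring
        _ ≤ _ := by gcongr
    have hcand : ∀ M : ℕ, 0 < M → 8 * ((k : ℝ) ^ r * √l / ((l : ℝ) ^ (r - 1) * (M * √M)))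
        ≤ n * (√l / (48 * (M * √M))) * ((k * p) ^ r / (3 * B)) := by
      intro M hM
      have hM0 : (0 : ℝ) < M := by exact_mod_cast hM
      have hsM : 0 < √(M : ℝ) := Real.sqrt_pos.2 hM0
      have e1 : n * (√l / (48 * (M * √M))) * ((k * p) ^ r / (3 * B))
          = (n * p ^ r) * ((k : ℝ) ^ r * √l / (M * √M)) / (144 * B) := by
        rw [mul_pow]
        field_simp
        ring
      rw [e1, le_div_iff₀ (by positivity)]
      have e2 : 8 * ((k : ℝ) ^ r * √l / ((l : ℝ) ^ (r - 1) * (M * √M))) * (144 * B)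
          = (1152 * B / (l : ℝ) ^ (r - 1)) * ((k : ℝ) ^ r * √l / (M * √M)) := by
        field_simp
        norm_num
      rw [e2]
      refine mul_le_mul_of_nonneg_right ?_ (by positivity)
      rwa [div_le_iff₀ (by positivity)]
    rcases lt_or_ge k l with hkl | hkl
    · have hw := le_layerWeight (l := l) (k := k) (M := l) (by omega) (by omega)
      refine hred _ _ _ hy (by positivity) hw (hcand l (by omega)) (by positivity) ?_
      have e : (k : ℝ) ^ r * √l / ((l : ℝ) ^ (r - 1) * (l * √l)) = (k / l : ℝ) ^ r := by
        rw [div_pow, ← mul_assoc, ← pow_succ, Nat.sub_add_cancel (by omega)]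
        field_simp
      rw [e, layerProb, if_pos hkl]
      have hz1 : (k / l : ℝ) ^ r ≤ 1 :=
        pow_le_one₀ (by positivity) (div_le_one_of_le₀ (by exact_mod_cast hkl.le) hl0.le)
      have hz0 : 0 ≤ (k / l : ℝ) ^ r := by positivity
      have hq : ((k + 1 : ℝ) / (2 * l)) ^ r ≤ (k / l : ℝ) ^ r := by
        refine pow_le_pow_left₀ (by positivity) ?_ r
        rw [div_le_div_iff₀ (by positivity) hl0]
        have : (1 : ℝ) ≤ k := by exact_mod_cast (by omega : 1 ≤ k)
        nlinarith
      set z := (k / l : ℝ) ^ r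
      calc Real.exp (-(8 * z)) ≤ 1 / (1 + 8 * z) := by
            rw [Real.exp_neg, one_div]
            exact inv_anti₀ (by positivity) (by linarith [Real.add_one_le_exp (8 * z)])
        _ ≤ 1 - z / 8 := by
            rw [div_le_iff₀ (by positivity)]
            nlinarith
        _ ≤ _ := by linarith
    · have hw := le_layerWeight (l := l) (k := k) (M := k) (by omega) (by omega)
      have hsk : 0 < √(k : ℝ) := Real.sqrt_pos.2 hk0
      have hsk2 : √(k : ℝ) * √k = k := Real.mul_self_sqrt hk0.le
      have hge : 8 * (√k / √l) ≤ 8 * ((k : ℝ) ^ r * √l / ((l : ℝ) ^ (r - 1) * (k * √k))) := by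
        refine mul_le_mul_of_nonneg_left ?_ (by norm_num)
        rw [div_le_div_iff₀ hsl (by positivity)]
        obtain ⟨s, rfl⟩ := Nat.exists_eq_add_of_le hr
        rw [show 2 + s - 1 = s + 1 by omega]
        have hlk : (l : ℝ) ^ s ≤ (k : ℝ) ^ s := pow_le_pow_left₀ hl0.le (by exact_mod_cast hkl) s
        calc √(k : ℝ) * ((l : ℝ) ^ (s + 1) * (k * √k)) = (√(k : ℝ) * √k) * k * l * (l : ℝ) ^ s := by
              ring
          _ = (k : ℝ) ^ 2 * l * (l : ℝ) ^ s := by rw [hsk2]; ring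
          _ ≤ (k : ℝ) ^ 2 * l * (k : ℝ) ^ s := by gcongr
          _ = (k : ℝ) ^ 2 * (√l * √l) * (k : ℝ) ^ s := by rw [hsl2]
          _ = _ := by ring
      refine hred _ _ (8 * (√k / √l)) hy (by positivity) hw (hge.trans (hcand k (by omega)))
        (by positivity) ?_
      rw [layerProb, if_neg (by omega)]
      set s := √(k : ℝ) / √l with hs
      have hs0 : 0 < s := by positivity
      have hs4 : s ^ 4 = (k / l : ℝ) ^ 2 := by
        rw [hs, div_pow, div_pow, show √(k : ℝ) ^ 4 = (√k * √k) ^ 2 by ring,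
          show √(l : ℝ) ^ 4 = (√l * √l) ^ 2 by ring, hsk2, hsl2]
      have hlk : (l / k : ℝ) ^ 2 = 1 / s ^ 4 := by
        rw [hs4, div_pow, div_pow, one_div_div]
      -- The fourth-order term of the exponential turns exp(-8 √(k/l)) into (l/k)^2, which is
      -- summable over k.
      have hexp := Real.pow_div_factorial_le_exp (8 * s) (by positivity) 4
      rw [hlk, Real.exp_neg]
      have h24 : ((Nat.factorial 4 : ℕ) : ℝ) = 24 := by norm_num [Nat.factorial]
      rw [h24] at hexp
      have hpos : 0 < s ^ 4 := by positivity
      calc (Real.exp (8 * s))⁻¹ ≤ (2 * s ^ 4)⁻¹ := by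
            refine inv_anti₀ (by positivity) (le_trans ?_ hexp)
            rw [mul_pow]
            linarith
        _ = 1 - (1 - 1 / s ^ 4 / 2) := by field_simp; ring

theorem bprob_not_built_le_exp {n r l m N : ℕ} (hr : 2 ≤ r) {p u x C : ℝ} (hu : 0 < u) (hx : 0 < x)
    (hrl : r ≤ l) (hlm : l ≤ m) (hxl : x * u ≤ l) (hp0 : 0 < p) (hmp : m * p ≤ 1 / 2)
    (hp : p ≤ 1 / 2) (hpn : n * p ^ r * u ^ (r - 1) = C ^ r)
    (hC : 1152 * ((r : ℝ) ^ r * r.factorial) ≤ C ^ r * x ^ (r - 1))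
    (hstart : 48 * l ≤ n * p ^ (r - 1)) (hN : 2 * (m + N * m ^ 2 : ℝ) ≤ n) :
    bprob (allEdges (Fin n)) p (fun ω => ¬ ∃ B : Finset (Fin n), B.card = m ∧ Built r ω B)
      ≤ Real.exp (-(N * Real.exp (-((2 * r + 5) * l)))) := by
  -- Each of the m layers holds a reserve of N m vertices for those discarded in failed attempts.
  -- The weights use n/4 vertices, rounding at most m, the reserves N m^2.
  have hsum : ∑ k ∈ Finset.range m, (⌈n * layerWeight l k⌉₊ + N * m) ≤ n := by
    have : (∑ k ∈ Finset.range m, (⌈n * layerWeight l k⌉₊ + N * m) : ℝ) ≤ n := by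
      calc (∑ k ∈ Finset.range m, (⌈n * layerWeight l k⌉₊ + N * m) : ℝ)
          ≤ ∑ k ∈ Finset.range m, ((n * layerWeight l k + 1) + N * m) := by
            refine Finset.sum_le_sum fun k _ => add_le_add_left (Nat.ceil_lt_add_one ?_).le _
            have := le_layerWeight (l := l) (k := k) (M := k + l + 1) (by omega) (by omega)
            have h2 : 0 ≤ √(l : ℝ) / (48 * ((k + l + 1 : ℕ) * √(k + l + 1 : ℕ))) := by positivity
            exact mul_nonneg (by positivity) (h2.trans this)
        _ = n * ∑ k ∈ Finset.range m, layerWeight l k + m + N * m ^ 2 := by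
            rw [Finset.sum_add_distrib, Finset.sum_add_distrib, ← Finset.mul_sum]
            simp
            ring
        _ ≤ n * (1 / 4) + m + N * m ^ 2 := by
            gcongr
            exact sum_layerWeight_le l m (by omega)
        _ ≤ n := by linarith
    exact_mod_cast this
  obtain ⟨L, hL, hLc⟩ := exists_disjoint_layers _ hsum
  refine (bprob_not_built_le hp0.le (by linarith) hL (sz := fun k => ⌈n * layerWeight l k⌉₊)
    (q := layerProb r l) (fun k _ => layerProb_nonneg r l k) (fun k _ => layerProb_le_one r l k)
    (fun k hk => layer_bound hr hu hx hrl hxl hp0 hmp hp hpn hC hstart hk)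
    (fun k hk => (hLc k hk).ge)).trans ?_
  refine (one_sub_pow_le_exp ?_ N).trans (Real.exp_le_exp.2 (neg_le_neg ?_))
  · exact Finset.prod_le_one (fun k _ => layerProb_nonneg r l k) fun k _ => layerProb_le_one r l k
  · gcongr
    exact le_prod_layerProb (by omega) hlm

end GrowthEstimates

/-! ### The threshold function. -/

section Threshold

theorem tendsto_log_natCast : Tendsto (fun n : ℕ => Real.log n) atTop atTop :=
  Real.tendsto_log_atTop.comp tendsto_natCast_atTop_atTop

theorem eventually_pow_le_exp (K : ℕ) {b δ : ℝ} (hb : 0 < b) (hδ : 0 < δ) :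
    ∀ᶠ u : ℝ in atTop, u ^ K ≤ δ * Real.exp (b * u) := by
  filter_upwards [(isLittleO_pow_exp_pos_mul_atTop K hb).bound hδ] with u hu
  rw [Real.norm_eq_abs, Real.norm_eq_abs, Real.abs_exp] at hu
  exact (le_abs_self _).trans hu

theorem thresholdProb_pos {n t : ℕ} (hn : 1 < n) : 0 < thresholdProb n t := by
  have h1 : (1 : ℝ) < n := by exact_mod_cast hn
  have := Real.log_pos h1
  unfold thresholdProb
  positivity

/-- The algebraic identity defining the threshold; the main estimates use its scaled form in place
of the explicit exponents. -/
theorem mul_thresholdProb_pow {n t : ℕ} (ht : 2 ≤ t) (hn : 1 < n) :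
    n * thresholdProb n t ^ (t - 1) * Real.log n ^ (t - 2) = 1 := by
  have h1 : (1 : ℝ) < n := by exact_mod_cast hn
  have hu := Real.log_pos h1
  obtain ⟨s, rfl⟩ := Nat.exists_eq_add_of_le ht
  have hs : ((s : ℝ) + 1) ≠ 0 := by positivity
  have e1 : ((2 + s : ℕ) : ℝ) - 1 = s + 1 := by push_cast; ring
  have e2 : ((2 + s : ℕ) : ℝ) - 2 = s := by push_cast; ring
  unfold thresholdProb
  rw [show 2 + s - 1 = s + 1 by omega, Nat.add_sub_cancel_left, e1, e2, mul_pow,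
    ← Real.rpow_natCast, ← Real.rpow_natCast, ← Real.rpow_mul (by linarith),
    ← Real.rpow_mul hu.le]
  push_cast
  rw [neg_mul, neg_mul, one_div_mul_cancel hs, div_mul_cancel₀ _ hs, Real.rpow_neg_one,
    Real.rpow_neg hu.le, Real.rpow_natCast]
  have : (n : ℝ) ≠ 0 := by linarith
  field_simp

theorem eventually_thresholdProb_mul_pow_le {t : ℕ} (ht : 2 ≤ t) (K : ℕ) {δ : ℝ} (hδ : 0 < δ) :
    ∀ᶠ n : ℕ in atTop, thresholdProb n t * Real.log n ^ K ≤ δ := by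
  have ht' : (2 : ℝ) ≤ t := by exact_mod_cast ht
  have ht0 : (0 : ℝ) < t - 1 := by linarith
  filter_upwards [tendsto_log_natCast.eventually (eventually_pow_le_exp K (one_div_pos.2 ht0) hδ),
    tendsto_log_natCast.eventually_ge_atTop 1, eventually_gt_atTop 0] with n hn h1 h0
  have hn0 : (0 : ℝ) < n := by exact_mod_cast h0
  have hle : thresholdProb n t ≤ Real.exp (-(1 / ((t : ℝ) - 1) * Real.log n)) := by
    unfold thresholdProb
    rw [Real.rpow_def_of_pos hn0, show Real.log n * -(1 / ((t : ℝ) - 1))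
      = -(1 / ((t : ℝ) - 1) * Real.log n) by ring]
    refine mul_le_of_le_one_right (Real.exp_pos _).le (Real.rpow_le_one_of_one_le_of_nonpos h1 ?_)
    exact neg_nonpos.2 (div_nonneg (by linarith) ht0.le)
  calc thresholdProb n t * Real.log n ^ K
      ≤ Real.exp (-(1 / ((t : ℝ) - 1) * Real.log n)) *
          (δ * Real.exp (1 / ((t : ℝ) - 1) * Real.log n)) :=
        mul_le_mul hle hn (by positivity) (Real.exp_pos _).le
    _ = δ := by
        rw [mul_left_comm, ← Real.exp_add]
        simp

end Threshold

/-! ### The supercritical regime. -/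

/-- The failure probability in the supercritical regime, as a function of `log n`. -/
noncomputable def supercriticalError (r : ℕ) (u : ℝ) : ℝ :=
  Real.exp (-Real.exp (u / 4 - (2 * r + 5))) + 2 * Real.exp (-u)

theorem tendsto_supercriticalError (r : ℕ) :
    Tendsto (fun n : ℕ => supercriticalError r (Real.log n)) atTop (𝓝 0) := by
  have h1 : Tendsto (fun u : ℝ => supercriticalError r u) atTop (𝓝 (0 + 2 * 0)) := by
    unfold supercriticalError
    refine Tendsto.add ?_ ?_
    · refine Real.tendsto_exp_neg_atTop_nhds_zero.comp (Real.tendsto_exp_atTop.comp ?_)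
      exact tendsto_atTop_add_const_right _ _ (tendsto_id.atTop_div_const (by norm_num))
    · exact Tendsto.const_mul _ Real.tendsto_exp_neg_atTop_nhds_zero
  rw [mul_zero, add_zero] at h1
  exact h1.comp tendsto_log_natCast

set_option maxHeartbeats 800000 in
theorem exists_supercritical_const (r : ℕ) (hr : 2 ≤ r) :
    ∃ C : ℝ, 0 < C ∧
      ∀ᶠ n : ℕ in atTop, 0 < C * thresholdProb n (r + 1) ∧ C * thresholdProb n (r + 1) ≤ 1 ∧
        bprob (allEdges (Fin n)) (C * thresholdProb n (r + 1)) (fun ω =>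
          ¬ ((∃ B : Finset (Fin n), B.card = ⌈Real.log n ^ 2⌉₊ ∧ Built r ω B) ∧
            Expanding r ⌈Real.log n ^ 2⌉₊ ω)) ≤ supercriticalError r (Real.log n) := by
  set B := (r : ℝ) ^ r * r.factorial with hB
  have hBpos : 0 < B := by
    have : (0 : ℝ) < r.factorial := by exact_mod_cast r.factorial_pos
    have : (0 : ℝ) < r := by exact_mod_cast (by omega : 0 < r)
    positivity
  -- Chosen so that exp(-(2r+5) x u) = n^(-1/4), which the n^(1/2) attempts outweigh.
  set x : ℝ := 1 / (4 * (2 * r + 5)) with hx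
  have hx0 : 0 < x := by positivity
  have hx1 : x ≤ 1 := by
    rw [hx]
    refine div_le_one_of_le₀ ?_ (by positivity)
    have : (0 : ℝ) ≤ r := by positivity
    linarith
  -- The 1 gives C ≤ C^r; the other terms meet the requirements of expansion and growth
  -- respectively.
  set C : ℝ := 1 + 4 * Real.exp (4 * (r + 1)) * B + 1152 * B / x ^ (r - 1) with hC
  have hp1 : 0 < 4 * Real.exp (4 * (r + 1)) * B := by positivity
  have hp2 : 0 < 1152 * B / x ^ (r - 1) := by positivity
  have hC1 : 1 ≤ C := by linarith
  have hCr : C ≤ C ^ r := le_self_pow₀ hC1 (by omega)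
  have hCa : 4 * Real.exp (4 * (r + 1)) * B ≤ C ^ r := by linarith
  have hCb : 1152 * B ≤ C ^ r * x ^ (r - 1) := by
    rw [← div_le_iff₀ (by positivity)]
    linarith
  have hC0 : 0 < C := by linarith
  refine ⟨C, hC0, ?_⟩
  have hsmall : ∀ (K : ℕ) {c : ℝ}, 0 < c →
      ∀ᶠ n : ℕ in atTop, C * thresholdProb n (r + 1) * Real.log n ^ K ≤ c := by
    intro K c hc
    filter_upwards [eventually_thresholdProb_mul_pow_le (t := r + 1) (by omega) K
      (div_pos hc hC0)] with n hn
    rw [le_div_iff₀ hC0] at hn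
    linarith
  filter_upwards [tendsto_log_natCast.eventually_ge_atTop 2,
    tendsto_log_natCast.eventually_ge_atTop r,
    tendsto_log_natCast.eventually_ge_atTop (r / x),
    tendsto_log_natCast.eventually_ge_atTop (1 / x),
    hsmall 2 (by norm_num : (0 : ℝ) < 1 / 4),
    hsmall r (by norm_num : (0 : ℝ) < 1 / 96),
    hsmall (r + 1) (by norm_num : (0 : ℝ) < 1 / 64),
    tendsto_log_natCast.eventually (eventually_pow_le_exp 4 (by norm_num : (0 : ℝ) < 1 / 2)
      (by norm_num : (0 : ℝ) < 1 / 64)),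
    eventually_gt_atTop 1] with n hu2 hur hurx hux hs2 hsr hsr1 hu4 hn1
  set u := Real.log n with hu
  set p := C * thresholdProb n (r + 1) with hp
  have hn0 : (0 : ℝ) < n := by exact_mod_cast (by omega : 0 < n)
  have hnu : Real.exp u = n := Real.exp_log hn0
  have hp0 : 0 < p := mul_pos hC0 (thresholdProb_pos hn1)
  have hpn : n * p ^ r * u ^ (r - 1) = C ^ r := by
    have := mul_thresholdProb_pow (t := r + 1) (by omega) hn1
    rw [Nat.add_sub_cancel, show r + 1 - 2 = r - 1 by omega] at this
    rw [hp, mul_pow]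
    calc _ = C ^ r * (n * thresholdProb n (r + 1) ^ r * u ^ (r - 1)) := by ring
      _ = C ^ r := by rw [this, mul_one]
  set m := ⌈u ^ 2⌉₊ with hm
  set l := ⌈x * u⌉₊ with hl
  set N := ⌈Real.exp (1 / 2 * u)⌉₊ with hN
  have hu1 : 4 ≤ u ^ 2 := by nlinarith
  have hmge : u ^ 2 ≤ m := Nat.le_ceil _
  have hmle : (m : ℝ) ≤ 2 * u ^ 2 := by
    have := (Nat.ceil_lt_add_one (by positivity : 0 ≤ u ^ 2)).le
    linarith
  have hxu : 1 ≤ x * u := by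
    rw [div_le_iff₀ hx0] at hux
    linarith
  have hxur : r ≤ x * u := by
    rw [div_le_iff₀ hx0] at hurx
    linarith
  have hlge : x * u ≤ l := Nat.le_ceil _
  have hlle' : (l : ℝ) ≤ x * u + 1 := (Nat.ceil_lt_add_one (by linarith)).le
  have hxuu : x * u ≤ u := mul_le_of_le_one_left (by linarith) hx1
  have huu : u ≤ u ^ 2 := le_self_pow₀ (by linarith) (by norm_num)
  have hlle : (l : ℝ) ≤ 2 * u := by linarith
  have hNge : Real.exp (1 / 2 * u) ≤ N := Nat.le_ceil _
  have hNle : (N : ℝ) ≤ 2 * Real.exp (1 / 2 * u) := by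
    have h1 := (Nat.ceil_lt_add_one (Real.exp_pos (1 / 2 * u)).le).le
    have h2 := Real.add_one_le_exp (1 / 2 * u)
    linarith
  have hmp : m * p ≤ 1 / 2 := by
    calc m * p ≤ 2 * u ^ 2 * p := by gcongr
      _ ≤ 1 / 2 := by linarith
  have hp12 : p ≤ 1 / 2 :=
    (le_mul_of_one_le_left hp0.le (by linarith : (1 : ℝ) ≤ m)).trans hmp
  have hrl : r ≤ l := by exact_mod_cast hxur.trans hlge
  have hlm : l ≤ m := Nat.ceil_le_ceil (hxuu.trans huu)
  have hupos : 0 < u := by linarith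
  have hnpr : ∀ c : ℝ, c * p * u ^ (r - 1) ≤ C ^ r → c ≤ n * p ^ (r - 1) := by
    intro c hc
    rw [← hpn] at hc
    have hupow : 0 < u ^ (r - 1) := by positivity
    have h1 := le_of_mul_le_mul_right hc hupow
    rw [show (n : ℝ) * p ^ r = n * p ^ (r - 1) * p by
      rw [mul_assoc, ← pow_succ, Nat.sub_add_cancel (by omega)]] at h1
    exact le_of_mul_le_mul_right h1 hp0
  have eur : u ^ r = u * u ^ (r - 1) := by rw [← pow_succ', Nat.sub_add_cancel (by omega)]
  have hC1r : 1 ≤ C ^ r := hC1.trans hCr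
  have hstart : 48 * (l : ℝ) ≤ n * p ^ (r - 1) := by
    refine hnpr _ (le_trans ?_ hC1r)
    calc 48 * (l : ℝ) * p * u ^ (r - 1) ≤ 48 * (2 * u) * p * u ^ (r - 1) := by gcongr
      _ = 96 * (p * u ^ r) := by rw [eur]; ring
      _ ≤ 1 := by linarith
  have h16 : 16 * u * (3 * u + r) ≤ n * p := by
    have h1 : 16 * u * (3 * u + r) ≤ n * p ^ (r - 1) := by
      refine hnpr _ (le_trans ?_ hC1r)
      calc 16 * u * (3 * u + r) * p * u ^ (r - 1) ≤ 16 * u * (3 * u + u) * p * u ^ (r - 1) := by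
            gcongr
        _ = 64 * (p * u ^ (r + 1)) := by rw [pow_succ, eur]; ring
        _ ≤ 1 := by linarith
    refine h1.trans (mul_le_mul_of_nonneg_left ?_ hn0.le)
    simpa using pow_le_pow_of_le_one hp0.le (by linarith) (by omega : 1 ≤ r - 1)
  have hsq : Real.exp (1 / 2 * u) * Real.exp (1 / 2 * u) = n := by
    rw [← Real.exp_add, ← hnu]
    ring_nf
  have hu4n : 64 * u ^ 4 ≤ Real.exp (1 / 2 * u) := by linarith
  have he1 : 1 ≤ Real.exp (1 / 2 * u) := Real.one_le_exp (by linarith)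
  have h64 : 64 * u ^ 4 * Real.exp (1 / 2 * u) ≤ n := by
    rw [← hsq]
    gcongr
  have hu24 : u ^ 2 ≤ u ^ 4 := pow_le_pow_right₀ (by linarith) (by norm_num)
  have hm2 : (m : ℝ) ^ 2 ≤ 4 * u ^ 4 := by
    calc (m : ℝ) ^ 2 ≤ (2 * u ^ 2) ^ 2 := by gcongr
      _ = 4 * u ^ 4 := by ring
  have hu4e : u ^ 4 ≤ u ^ 4 * Real.exp (1 / 2 * u) := le_mul_of_one_le_right (by positivity) he1
  have hNm : 2 * (m + N * m ^ 2 : ℝ) ≤ n := by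
    have : (N : ℝ) * m ^ 2 ≤ 2 * Real.exp (1 / 2 * u) * (4 * u ^ 4) := by gcongr
    linarith
  have hn16 : 16 * u ≤ n := by linarith
  refine ⟨hp0, by linarith, ?_⟩
  have hbuilt := bprob_not_built_le_exp hr hupos hx0 hrl hlm hlge hp0 hmp hp12 hpn hCb hstart hNm
  have hexpd := bprob_not_expanding_le_of_pow_eq hr hu hu2 hp0 hp12 hpn hCa hmge (hrl.trans hlm)
    h16 hn16
  calc _ ≤ bprob (allEdges (Fin n)) p (fun ω =>
          (¬ ∃ B : Finset (Fin n), B.card = m ∧ Built r ω B) ∨ ¬ Expanding r m ω) :=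
        bprob_mono hp0.le (by linarith) fun ω _ h => not_and_or.1 h
    _ ≤ _ := bprob_or_le hp0.le (by linarith) _ _
    _ ≤ _ := add_le_add hbuilt hexpd
    _ ≤ supercriticalError r u := by
        unfold supercriticalError
        refine add_le_add (Real.exp_le_exp.2 (neg_le_neg ?_)) ?_
        · have e : (2 * (r : ℝ) + 5) * (x * u) = u / 4 := by
            rw [hx]
            field_simp
          calc Real.exp (u / 4 - (2 * r + 5))
              = Real.exp (1 / 2 * u) * Real.exp (-((2 * r + 5) * (x * u + 1))) := by
                rw [← Real.exp_add, mul_add, e]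
                ring_nf
            _ ≤ N * Real.exp (-((2 * r + 5) * l)) := by gcongr
        · have e : Real.exp (-(2 * u)) = Real.exp (-u) / n := by
            rw [← hnu, ← Real.exp_sub]
            ring_nf
          rw [e, ← mul_div_assoc, div_le_iff₀ hn0]
          have h1n : (1 : ℝ) ≤ n := by exact_mod_cast hn1.le
          have := Real.exp_pos (-u)
          nlinarith

theorem whp_wsat_star_eq {t : ℕ} (ht : 3 ≤ t) :
    ∃ C : ℝ, 0 < C ∧ ∀ p : ℕ → unitInterval,
      (∀ᶠ n : ℕ in atTop, C * thresholdProb n t < (p n : ℝ)) →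
      Whp p (fun n G =>
        wsat G (starGraphK t) = wsat (⊤ : SimpleGraph (Fin n)) (starGraphK t)) := by
  obtain ⟨r, rfl⟩ : ∃ r, t = r + 1 := ⟨t - 1, by omega⟩
  obtain ⟨C, hC, hev⟩ := exists_supercritical_const r (by omega)
  refine ⟨C, hC, fun p hp => whp_of_bprob_not_le (tendsto_supercriticalError r) ?_⟩
  filter_upwards [hev, hp, eventually_ge_atTop (r + 1), eventually_gt_atTop 0,
    tendsto_log_natCast.eventually_ge_atTop (r + 1 : ℝ),
    tendsto_log_natCast.eventually (eventually_pow_le_exp 2 (by norm_num : (0 : ℝ) < 1 / 1)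
      (by norm_num : (0 : ℝ) < 1 / 2)),
    eventually_gt_atTop (4 + 2 * (r + 1).choose 2)]
    with n hn hpn hnt hn0 hur hu2 hnc
  obtain ⟨h0, h1, hb⟩ := hn
  have hlt := hpn.le
  have hnR : (0 : ℝ) < n := by exact_mod_cast hn0
  set m := ⌈Real.log n ^ 2⌉₊ with hm
  have hr0 : (0 : ℝ) ≤ r := by positivity
  have htm : r + 1 ≤ m := by
    have h1 : ((r + 1 : ℕ) : ℝ) ≤ m := by
      refine le_trans ?_ (Nat.le_ceil _)
      push_cast
      nlinarith
    exact_mod_cast h1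
  have hmn : m + (r + 1).choose 2 < Fintype.card (Fin n) := by
    rw [Fintype.card_fin]
    have h1 := (Nat.ceil_lt_add_one (by positivity : 0 ≤ Real.log n ^ 2)).le
    rw [div_one, one_mul, Real.exp_log hnR] at hu2
    have h2 : (4 + 2 * (r + 1).choose 2 : ℝ) < n := by exact_mod_cast hnc
    have h3 : ((m + (r + 1).choose 2 : ℕ) : ℝ) < n := by
      push_cast
      rw [← hm] at h1
      linarith
    exact_mod_cast h3
  have hgood := bprob_not (allEdges (Fin n)) (C * thresholdProb n (r + 1)) (fun ω =>
          ((∃ B : Finset (Fin n), B.card = m ∧ Built r ω B) ∧ Expanding r m ω))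
  -- Monotonicity in p is applied to the sufficient condition, which is visibly increasing, and not
  -- to the equality of saturation numbers.
  have hmono := bprob_mono_param (s := allEdges (Fin n)) h0.le hlt (p n).2.2 (P := fun ω =>
          ((∃ B : Finset (Fin n), B.card = m ∧ Built r ω B) ∧ Expanding r m ω))
    fun a b hab h => ⟨let ⟨B, hB, hBb⟩ := h.1; ⟨B, hB, hBb.mono hab⟩, h.2.mono hab⟩
  rw [bprob_not]
  have hfin : bprob (allEdges (Fin n)) (p n) (fun ω =>
          ((∃ B : Finset (Fin n), B.card = m ∧ Built r ω B) ∧ Expanding r m ω)) ≤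
      bprob (allEdges (Fin n)) (p n) (fun ω => wsat (edgeGraph ω) (starGraphK (r + 1))
        = wsat (⊤ : SimpleGraph (Fin n)) (starGraphK (r + 1))) := by
    refine bprob_mono (p n).2.1 (p n).2.2 fun ω _ ⟨⟨B, hB, hbuilt⟩, hE⟩ => ?_
    rw [wsat_top_star (by omega) hnt]
    exact wsat_star_eq_of_built (by omega) htm hmn hE hB hbuilt
  linarith

/-! ### Obstructions in the subcritical regime. -/

section Subcritical

variable {V : Type*} [Fintype V] [DecidableEq V]

theorem ncard_inside_edgeGraph_le (ω : Finset (Sym2 V)) (W : Finset V) :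
    (inside (edgeGraph ω) (W : Set V)).ncard ≤ (ω ∩ pairsIn W).card := by
  rw [← Set.ncard_coe_finset]
  refine Set.ncard_le_ncard ?_ (Set.toFinite _)
  rintro e ⟨he, hx⟩
  induction e using Sym2.ind with
  | _ x y =>
    rw [SimpleGraph.mem_edgeSet, SimpleGraph.fromEdgeSet_adj] at he
    rw [Finset.mem_coe, Finset.mem_inter, mem_pairsIn]
    exact ⟨he.1, hx x (by simp), hx y (by simp), he.2⟩

/-- If the weak saturation number for the star with `r + 1` leaves equals `c`, then there is a
dense set of `m` vertices or a small vertex cover. -/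
theorem exists_dense_or_cover {r m c : ℕ} {ω : Finset (Sym2 V)}
    (hm : m + c ≤ Fintype.card V) (hw : wsat (edgeGraph ω) (starGraphK (r + 1)) = c) :
    (∃ W : Finset V, W.card = m ∧ r * m - c ≤ (ω ∩ pairsIn W).card) ∨
      ∃ B : Finset V, B.card = m + c ∧ Disjoint ω (pairsIn Bᶜ) := by
  classical
  obtain ⟨F, hF, hcard⟩ := exists_ncard_eq_wsat (edgeGraph ω) (starGraphK (r + 1))
  rw [hw] at hcard
  obtain ⟨A, hA, hcov⟩ := hF.exists_activation
  rw [Nat.add_sub_cancel] at hA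
  rcases le_or_gt m A.card with h | h
  · obtain ⟨W, -, hW, hact⟩ := hA.exists_subset h
    refine Or.inl ⟨W, hW, ?_⟩
    have h1 := hact.le_ncard_inside_add
    have h2 := ncard_inside_edgeGraph_le ω W
    have h3 : (touching F W).ncard ≤ F.edgeSet.ncard :=
      Set.ncard_le_ncard (fun e he => he.1) (Set.toFinite _)
    rw [hW] at h1
    omega
  · right
    set T : Finset V := F.edgeFinset.image fun e => e.out.1 with hT
    have hTc : T.card ≤ c := by
      refine Finset.card_image_le.trans (le_of_eq ?_)
      rw [← hcard, Set.ncard_eq_toFinset_card']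
      rfl
    obtain ⟨B, hB, -, hBc⟩ := Finset.exists_subsuperset_card_eq (Finset.subset_univ (A ∪ T))
      (show (A ∪ T).card ≤ m + c from (Finset.card_union_le _ _).trans (by omega)) (by simpa using hm)
    refine ⟨B, hBc, Finset.disjoint_left.2 fun e he heB => ?_⟩
    induction e using Sym2.ind with
    | _ x y =>
      rw [mem_pairsIn, Finset.mem_compl, Finset.mem_compl] at heB
      have hxy : (edgeGraph ω).Adj x y := by
        rw [SimpleGraph.fromEdgeSet_adj]
        exact ⟨he, heB.2.2⟩
      rcases hcov x y hxy with h | h | h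
      · have hmem : (s(x, y)).out.1 ∈ T :=
          Finset.mem_image_of_mem _ (SimpleGraph.mem_edgeFinset.2 h)
        have hB' := hB (Finset.mem_union_right A hmem)
        rcases Sym2.mem_iff.1 (Sym2.out_fst_mem s(x, y)) with h' | h'
        · exact heB.1 (h' ▸ hB')
        · exact heB.2.1 (h' ▸ hB')
      · exact heB.1 (hB (Finset.mem_union_left _ h))
      · exact heB.2.1 (hB (Finset.mem_union_left _ h))

/-- All degrees are at most 1 < r, so no vertex can be activated and `F` must be the whole graph. -/
theorem wsat_star_eq_card {r : ℕ} (hr : 2 ≤ r) {ω : Finset (Sym2 V)} (hω : ω ⊆ allEdges V)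
    (hcherry : ∀ v u w, u ≠ w → s(v, u) ∈ ω → s(v, w) ∉ ω) :
    wsat (edgeGraph ω) (starGraphK (r + 1)) = ω.card := by
  obtain ⟨F, hF, hcard⟩ := exists_ncard_eq_wsat (edgeGraph ω) (starGraphK (r + 1))
  obtain ⟨A, hA, hcov⟩ := hF.exists_activation
  have hA0 : A = ∅ := hA.eq_empty fun v ⟨T, hT, hadj⟩ => by
    obtain ⟨u, hu, w, hw, huw⟩ := Finset.one_lt_card.1 (by omega : 1 < T.card)
    have h1 := (hadj u hu).1
    have h2 := (hadj w hw).1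
    rw [SimpleGraph.fromEdgeSet_adj] at h1 h2
    exact hcherry v u w huw h1.1 h2.1
  have hFG : F = edgeGraph ω := le_antisymm hF.1 fun x y hxy => by
    have := hcov x y hxy
    simpa [hA0] using this
  rw [← hcard, hFG, edgeSet_edgeGraph hω, Set.ncard_coe_finset]

theorem bprob_exists_cherry_le {p : ℝ} (h0 : 0 ≤ p) (h1 : p ≤ 1) :
    bprob (allEdges V) p (fun ω => ∃ v u w, u ≠ w ∧ s(v, u) ∈ ω ∧ s(v, w) ∈ ω)
      ≤ (Fintype.card V : ℝ) ^ 3 * p ^ 2 := by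
  let t : Finset (V × V × V) :=
    Finset.univ.filter fun x => x.2.1 ≠ x.2.2 ∧ x.1 ≠ x.2.1 ∧ x.1 ≠ x.2.2
  calc _ ≤ bprob (allEdges V) p
          (fun ω => ∃ x ∈ t, ({s(x.1, x.2.1), s(x.1, x.2.2)} : Finset (Sym2 V)) ⊆ ω) := by
        refine bprob_mono h0 h1 fun ω hω ⟨v, u, w, huw, hu, hw⟩ => ⟨(v, u, w), ?_, ?_⟩
        · simp only [t, Finset.mem_filter, Finset.mem_univ, true_and]
          exact ⟨huw, mem_allEdges.1 (hω hu), mem_allEdges.1 (hω hw)⟩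
        · simp [Finset.insert_subset_iff, hu, hw]
    _ ≤ ∑ x ∈ t, p ^ 2 := by
        refine (bprob_exists_le h0 h1 _ _).trans (Finset.sum_le_sum fun x hx => le_of_eq ?_)
        simp only [t, Finset.mem_filter, Finset.mem_univ, true_and] at hx
        rw [bprob_subset, Finset.card_pair]
        · exact fun h => hx.1 (Sym2.congr_right.1 h)
        · simp [Finset.insert_subset_iff, mem_allEdges, hx.2]
    _ ≤ _ := by
        rw [Finset.sum_const, nsmul_eq_mul]
        refine mul_le_mul_of_nonneg_right ?_ (by positivity)
        have := Finset.card_le_univ t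
        rw [Fintype.card_prod, Fintype.card_prod] at this
        calc (t.card : ℝ) ≤ ((Fintype.card V * (Fintype.card V * Fintype.card V) : ℕ) : ℝ) := by
              exact_mod_cast this
          _ = _ := by push_cast; ring

theorem pairsIn_subset_allEdges (W : Finset V) : pairsIn W ⊆ allEdges V := by
  intro e
  induction e using Sym2.ind with
  | _ x y =>
    rw [mem_pairsIn, mem_allEdges]
    exact fun h => h.2.2

theorem bprob_exists_cover_le {p : ℝ} (h0 : 0 ≤ p) (h1 : p ≤ 1) (b : ℕ) :
    bprob (allEdges V) p (fun ω => ∃ B : Finset V, B.card = b ∧ Disjoint ω (pairsIn Bᶜ))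
      ≤ ((Fintype.card V).choose b : ℝ) * (1 - p) ^ (Fintype.card V - b).choose 2 := by
  calc _ ≤ bprob (allEdges V) p
          (fun ω => ∃ B ∈ Finset.powersetCard b Finset.univ, Disjoint ω (pairsIn Bᶜ)) := by
        refine bprob_mono h0 h1 fun ω hω ⟨B, hB, h⟩ => ⟨B, ?_, h⟩
        simp [Finset.mem_powersetCard, hB]
    _ ≤ ∑ B ∈ Finset.powersetCard b (Finset.univ : Finset V),
          (1 - p) ^ (Fintype.card V - b).choose 2 := by
        refine (bprob_exists_le h0 h1 _ _).trans (Finset.sum_le_sum fun B hB => le_of_eq ?_)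
        rw [bprob_disjoint (pairsIn_subset_allEdges _), card_pairsIn, Finset.card_compl,
          (Finset.mem_powersetCard.1 hB).2]
    _ = _ := by
        rw [Finset.sum_const, nsmul_eq_mul, Finset.card_powersetCard, Finset.card_univ]

/-- Union bound with the Chernoff parameter z = 1/(pm): the generating function is at most (1 +
1/m)^(m^2) ≤ e^m, and the other factor e^m comes from binom(n,m) ≤ (en/m)^m. -/
theorem bprob_exists_dense_le {p : ℝ} (h0 : 0 < p) (h1 : p ≤ 1) {m : ℕ} (hm : 1 ≤ m)
    (hpm : p * m ≤ 1) (j : ℕ) :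
    bprob (allEdges V) p
      (fun ω => ∃ W : Finset V, W.card = m ∧ j ≤ (ω ∩ pairsIn W).card)
      ≤ (Fintype.card V : ℝ) ^ m * Real.exp (2 * m) / (m : ℝ) ^ m * (p * m) ^ j := by
  have hm0 : (0 : ℝ) < m := by exact_mod_cast hm
  have hM : (m.choose 2 : ℝ) ≤ m * m := by
    have := Nat.choose_le_pow m 2
    rw [pow_two] at this
    exact_mod_cast this
  have hz : 1 ≤ 1 / (p * m) := by rw [le_div_iff₀ (by positivity)]; linarith
  have hone : ∀ W ∈ Finset.powersetCard m (Finset.univ : Finset V),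
      bprob (allEdges V) p (fun ω => j ≤ (ω ∩ pairsIn W).card) ≤ Real.exp m * (p * m) ^ j := by
    intro W hW
    refine (bprob_card_ge_le (pairsIn_subset_allEdges W) h0.le h1 hz j).trans ?_
    rw [card_pairsIn, (Finset.mem_powersetCard.1 hW).2, one_div, inv_pow, div_inv_eq_mul]
    refine mul_le_mul_of_nonneg_right ?_ (by positivity)
    have e : p * (p * m)⁻¹ = 1 / m := by field_simp
    rw [e]
    have e1 : 1 - p + 1 / (m : ℝ) ≤ Real.exp (1 / m) := by
      linarith [Real.add_one_le_exp (1 / (m : ℝ))]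
    have e0 : 0 ≤ 1 - p + 1 / (m : ℝ) := by
      have : (0 : ℝ) < 1 / m := by positivity
      linarith
    refine (pow_le_pow_left₀ e0 e1 _).trans ?_
    rw [← Real.exp_nat_mul]
    refine Real.exp_le_exp.2 ?_
    rw [mul_one_div, div_le_iff₀ hm0]
    exact hM
  have hchoose : ((Fintype.card V).choose m : ℝ)
      ≤ (Fintype.card V : ℝ) ^ m * Real.exp m / (m : ℝ) ^ m := by
    have hf : (0 : ℝ) < m.factorial := by exact_mod_cast m.factorial_pos
    have h := Real.pow_div_factorial_le_exp (m : ℝ) hm0.le m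
    rw [div_le_iff₀ hf] at h
    refine (Nat.choose_le_pow_div m _).trans ?_
    rw [div_le_div_iff₀ hf (by positivity), mul_assoc]
    gcongr
  calc _ ≤ bprob (allEdges V) p
          (fun ω => ∃ W ∈ Finset.powersetCard m Finset.univ, j ≤ (ω ∩ pairsIn W).card) := by
        refine bprob_mono h0.le h1 fun ω hω ⟨B, hB, h⟩ => ⟨B, ?_, h⟩
        simp [Finset.mem_powersetCard, hB]
    _ ≤ ∑ W ∈ Finset.powersetCard m (Finset.univ : Finset V), Real.exp m * (p * m) ^ j :=
        (bprob_exists_le h0.le h1 _ _).trans (Finset.sum_le_sum hone)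
    _ = ((Fintype.card V).choose m : ℝ) * (Real.exp m * (p * m) ^ j) := by
        rw [Finset.sum_const, nsmul_eq_mul, Finset.card_powersetCard, Finset.card_univ]
    _ ≤ (Fintype.card V : ℝ) ^ m * Real.exp m / (m : ℝ) ^ m * (Real.exp m * (p * m) ^ j) := by
        gcongr
    _ = _ := by
        rw [two_mul, Real.exp_add]
        ring

end Subcritical

/-! ### First moment estimates and conclusion. -/

theorem dense_bound {n r m c : ℕ} (hr : 2 ≤ r) {p p0 u κ : ℝ} (hnu : Real.exp u = n) (hu : 0 < u)
    (hum : u ≤ m) (hm2 : (m : ℝ) ≤ 2 * u) (hp : 0 < p) (hpp0 : p ≤ p0)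
    (hnp : n * p0 ^ r * u ^ (r - 1) = κ ^ r)
    (hκ : 2 ^ r * κ ^ r ≤ Real.exp (-(c + 3))) (hlow : 1 ≤ n * (p0 * m)) (hcm : c ≤ r * m) :
    (n : ℝ) ^ m * Real.exp (2 * m) / (m : ℝ) ^ m * (p * m) ^ (r * m - c) ≤ Real.exp (-u) := by
  have hm0 : (0 : ℝ) < m := hu.trans_le hum
  have hp0 : 0 < p0 := hp.trans_le hpp0
  have hq0 : 0 < p0 * m := by positivity
  have hn0 : (0 : ℝ) < n := hnu ▸ Real.exp_pos u
  -- With r m edges the bound would be the m-th power of this base. The c missing edges cost a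
  -- factor of at most n^c by `hlow`, which is why the exponent must beat c. Passing from p to p0 is
  -- needed for `hlow`, as p may be far smaller.
  have hbase : n * Real.exp 2 / m * (p0 * m) ^ r ≤ Real.exp (-(c + 1)) := by
    have e1 : (m : ℝ) ^ r = m * (m : ℝ) ^ (r - 1) := by
      rw [← pow_succ', Nat.sub_add_cancel (by omega)]
    have hκ0 : 0 ≤ κ ^ r := by rw [← hnp]; positivity
    calc n * Real.exp 2 / m * (p0 * m) ^ r = Real.exp 2 * (n * p0 ^ r * (m : ℝ) ^ (r - 1)) := by
          rw [mul_pow, e1]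
          field_simp
      _ ≤ Real.exp 2 * (n * p0 ^ r * (2 * u) ^ (r - 1)) := by gcongr
      _ = Real.exp 2 * (2 ^ (r - 1) * κ ^ r) := by rw [mul_pow, ← hnp]; ring
      _ ≤ Real.exp 2 * (2 ^ r * κ ^ r) := by
          gcongr
          · norm_num
          · omega
      _ ≤ Real.exp 2 * Real.exp (-(c + 3)) := by gcongr
      _ = Real.exp (-(c + 1)) := by rw [← Real.exp_add]; ring_nf
  have hsplit : (p0 * m) ^ (r * m - c) * (p0 * m) ^ c = ((p0 * m) ^ r) ^ m := by
    rw [← pow_add, Nat.sub_add_cancel hcm, pow_mul]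
  calc (n : ℝ) ^ m * Real.exp (2 * m) / (m : ℝ) ^ m * (p * m) ^ (r * m - c)
      ≤ (n : ℝ) ^ m * Real.exp (2 * m) / (m : ℝ) ^ m * (p0 * m) ^ (r * m - c) := by gcongr
    _ ≤ (n : ℝ) ^ m * Real.exp (2 * m) / (m : ℝ) ^ m *
          ((p0 * m) ^ (r * m - c) * (n * (p0 * m)) ^ c) := by
        gcongr
        exact le_mul_of_one_le_right (by positivity) (one_le_pow₀ hlow)
    _ = (n : ℝ) ^ m * Real.exp (2 * m) / (m : ℝ) ^ m *
          ((p0 * m) ^ (r * m - c) * (p0 * m) ^ c) * (n : ℝ) ^ c := by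
        rw [mul_pow (n : ℝ)]
        generalize (p0 * m) ^ (r * m - c) = X
        generalize (p0 * m) ^ c = Y
        ring
    _ = (n * Real.exp 2 / m * (p0 * m) ^ r) ^ m * (n : ℝ) ^ c := by
        rw [hsplit, mul_comm 2 (m : ℝ), Real.exp_nat_mul, mul_pow _ ((p0 * m) ^ r), div_pow,
          mul_pow (n : ℝ) (Real.exp 2)]
    _ ≤ Real.exp (-(c + 1)) ^ m * (n : ℝ) ^ c := by gcongr
    _ = Real.exp (-((c + 1) * m) + c * u) := by
        rw [← hnu, ← Real.exp_nat_mul, ← Real.exp_nat_mul, ← Real.exp_add]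
        ring_nf
    _ ≤ Real.exp (-u) := by
        refine Real.exp_le_exp.2 ?_
        have hc0 : (0 : ℝ) ≤ c := by positivity
        nlinarith

/-- There are at most exp(3u^2) candidate covers, while about n^2/8 pairs avoid each one, with n^2 q
at least n^(1/4). -/
theorem cover_bound {n b : ℕ} {q u : ℝ} (hnu : Real.exp u = n) (hu : 1 ≤ u) (hb : (b : ℝ) ≤ 3 * u)
    (hbn : b ≤ n) (hn8 : 8 ≤ n) (hun : u ≤ 1 / 8 * n) (hu2 : u ^ 2 ≤ 1 / 32 * Real.exp (1 / 4 * u))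
    (hq1 : q ≤ 1) (hq : Real.exp (-(7 / 4 * u)) ≤ q) :
    (n.choose b : ℝ) * (1 - q) ^ (n - b).choose 2 ≤ Real.exp (-u) := by
  have hq0 : 0 < q := (Real.exp_pos _).trans_le hq
  have hn8R : (8 : ℝ) ≤ n := by exact_mod_cast hn8
  have hlog : Real.log n = u := by rw [← hnu, Real.log_exp]
  have h1 : (n.choose b : ℝ) ≤ Real.exp (3 * u * u) := by
    refine (choose_le_exp (by omega)).trans (Real.exp_le_exp.2 ?_)
    rw [hlog]
    exact mul_le_mul_of_nonneg_right hb (by linarith)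
  have h2 := one_sub_pow_le_exp hq1 ((n - b).choose 2)
  refine (mul_le_mul h1 h2 (pow_nonneg (by linarith) _) (Real.exp_pos _).le).trans ?_
  rw [← Real.exp_add]
  refine Real.exp_le_exp.2 ?_
  rw [Nat.cast_choose_two, Nat.cast_sub hbn]
  have h3 : (n : ℝ) / 2 + 1 ≤ n - b := by linarith
  have h4 : (n : ℝ) / 2 * (n / 2) ≤ (n - b) * (n - b - 1) :=
    mul_le_mul (by linarith) (by linarith) (by linarith) (by linarith)
  have h5 : Real.exp (1 / 4 * u) ≤ (n : ℝ) ^ 2 * q := by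
    calc Real.exp (1 / 4 * u) = (n : ℝ) ^ 2 * Real.exp (-(7 / 4 * u)) := by
          rw [← hnu, ← Real.exp_nat_mul, ← Real.exp_add]
          push_cast
          ring_nf
      _ ≤ _ := by gcongr
  have h6 := mul_le_mul_of_nonneg_right h4 hq0.le
  have h7 : u ≤ u ^ 2 := le_self_pow₀ hu (by norm_num)
  linarith

set_option maxHeartbeats 400000 in
theorem whp_wsat_star_ne {t : ℕ} (ht : 3 ≤ t) :
    ∃ c : ℝ, 0 < c ∧ ∀ p : ℕ → unitInterval,
      (fun n : ℕ => 1 / (n : ℝ) ^ 2) =o[atTop] (fun n : ℕ => (p n : ℝ)) →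
      (∀ᶠ n : ℕ in atTop, (p n : ℝ) < c * thresholdProb n t) →
      Whp p (fun n G =>
        wsat G (starGraphK t) ≠ wsat (⊤ : SimpleGraph (Fin n)) (starGraphK t)) := by
  obtain ⟨r, rfl⟩ : ∃ r, t = r + 1 := ⟨t - 1, by omega⟩
  set c := (r + 1).choose 2 with hc
  set κ : ℝ := Real.exp (-(c + 3)) / 2 ^ r with hκdef
  have hκ0 : 0 < κ := by positivity
  have hκ1 : κ ≤ 1 := by
    refine div_le_one_of_le₀ ?_ (by positivity)
    refine le_trans ?_ (one_le_pow₀ (by norm_num))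
    exact Real.exp_le_one_iff.2 (by have : (0 : ℝ) ≤ c := by positivity
                                    linarith)
  have hκ : 2 ^ r * κ ^ r ≤ Real.exp (-(c + 3)) := by
    calc 2 ^ r * κ ^ r ≤ 2 ^ r * κ := by
          gcongr
          exact pow_le_of_le_one hκ0.le hκ1 (by omega)
      _ = _ := by rw [hκdef]; field_simp
  refine ⟨κ, hκ0, fun p hlo hup => ?_⟩
  have htend : Tendsto (fun n : ℕ => (p n : ℝ) * (n : ℝ) ^ 2) atTop atTop := by
    rw [tendsto_atTop]
    intro b
    have hb : 0 < 1 / (|b| + 1) := by positivity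
    filter_upwards [hlo.bound hb, eventually_gt_atTop 0] with n hn h0
    have hn0 : (0 : ℝ) < n := by exact_mod_cast h0
    rw [Real.norm_of_nonneg (by positivity), Real.norm_of_nonneg (p n).2.1, one_div_mul_eq_div,
      div_le_div_iff₀ (by positivity) (by positivity), one_mul] at hn
    linarith [le_abs_self b]
  -- The sum of the errors of both regimes, because p may switch between them as n varies.
  let ε : ℕ → ℝ := fun n => 2 * Real.exp (-Real.log n) + (Real.exp (-(Real.log n / 2)) +
    2 ^ c * Real.exp (-((p n : ℝ) * (n : ℝ) ^ 2 / 8)))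
  have hε : Tendsto ε atTop (𝓝 0) := by
    have h1 : Tendsto (fun n : ℕ => Real.exp (-Real.log n)) atTop (𝓝 0) :=
      Real.tendsto_exp_neg_atTop_nhds_zero.comp tendsto_log_natCast
    have h2 : Tendsto (fun n : ℕ => Real.exp (-(Real.log n / 2))) atTop (𝓝 0) :=
      Real.tendsto_exp_neg_atTop_nhds_zero.comp (tendsto_log_natCast.atTop_div_const (by norm_num))
    have h3 : Tendsto (fun n : ℕ => Real.exp (-((p n : ℝ) * (n : ℝ) ^ 2 / 8))) atTop (𝓝 0) :=
      Real.tendsto_exp_neg_atTop_nhds_zero.comp (htend.atTop_div_const (by norm_num))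
    have := (h1.const_mul 2).add (h2.add (h3.const_mul (2 ^ c)))
    simpa using this
  refine whp_of_bprob_not_le hε ?_
  filter_upwards [hup, htend.eventually_gt_atTop 0, eventually_ge_atTop (r + 1),
    eventually_gt_atTop 1, tendsto_log_natCast.eventually_ge_atTop 1,
    tendsto_log_natCast.eventually_ge_atTop (c : ℝ),
    eventually_thresholdProb_mul_pow_le (t := r + 1) (by omega) 1 (by norm_num : (0 : ℝ) < 1 / 2),
    eventually_thresholdProb_mul_pow_le (t := r + 1) (by omega) (r - 1) hκ0,
    tendsto_log_natCast.eventually (eventually_pow_le_exp 2 (by norm_num : (0 : ℝ) < 1 / 4)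
      (by norm_num : (0 : ℝ) < 1 / 32)),
    tendsto_log_natCast.eventually (eventually_pow_le_exp 1 one_pos
      (by norm_num : (0 : ℝ) < 1 / 8)),
    eventually_ge_atTop 8]
    with n hpn hpos hnt hn1 hu1 huc hs1 hsr hu2 hun hn8
  simp only [not_not, pow_one, one_mul] at *
  set u := Real.log n with hu
  set q : ℝ := (p n : ℝ) with hq
  set p0 := κ * thresholdProb n (r + 1) with hp0def
  have hq0 : 0 < q := by
    have := (p n).2.1
    rcases this.lt_or_eq with h | h
    · exact h
    · rw [hq, ← h] at hpos
      simp at hpos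
  have hq1 : q ≤ 1 := (p n).2.2
  have hn0 : (0 : ℝ) < n := by exact_mod_cast (by omega : 0 < n)
  have hn8R : (8 : ℝ) ≤ n := by exact_mod_cast hn8
  have hnu : Real.exp u = n := Real.exp_log hn0
  rw [hnu] at hun
  have hthr := thresholdProb_pos (t := r + 1) hn1
  rw [wsat_top_star (by omega) hnt]
  change _ ≤ 2 * Real.exp (-u) + (Real.exp (-(u / 2)) + 2 ^ c * Real.exp (-(q * (n : ℝ) ^ 2 / 8)))
  -- Any exponent strictly between 3/2 and 2 separates the regimes: above 3/2 two edges sharing a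
  -- vertex are unlikely (n^3 q^2 is small), below 2 a cover of size O(u) is.
  rcases le_or_gt q (Real.exp (-(7 / 4 * u))) with hsparse | hdense
  · refine le_trans ?_ (le_add_of_nonneg_left (by positivity))
    calc _ ≤ bprob (allEdges (Fin n)) q (fun ω => (∃ v u w, u ≠ w ∧ s(v, u) ∈ ω ∧ s(v, w) ∈ ω) ∨
            (ω ∩ allEdges (Fin n)).card ≤ c) := by
          refine bprob_mono hq0.le hq1 fun ω hω h => ?_
          by_contra! hcon
          rw [wsat_star_eq_card (by omega) hω hcon.1] at h
          rw [Finset.inter_eq_left.2 hω] at hcon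
          exact hcon.2.ne' h
      _ ≤ _ := bprob_or_le hq0.le hq1 _ _
      _ ≤ _ := by
          refine add_le_add ((bprob_exists_cherry_le hq0.le hq1).trans ?_)
            ((bprob_card_le_le subset_rfl hq0.le hq1 c).trans ?_)
          · rw [Fintype.card_fin]
            calc (n : ℝ) ^ 3 * q ^ 2 ≤ (n : ℝ) ^ 3 * Real.exp (-(7 / 4 * u)) ^ 2 := by gcongr
              _ = Real.exp (-(u / 2)) := by
                  rw [← hnu, ← Real.exp_nat_mul, ← Real.exp_nat_mul, ← Real.exp_add]
                  push_cast
                  ring_nf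
          · rw [card_allEdges, Fintype.card_fin]
            refine mul_le_mul_of_nonneg_left ?_ (by positivity)
            refine (one_sub_pow_le_exp (by linarith) _).trans (Real.exp_le_exp.2 (neg_le_neg ?_))
            rw [Nat.cast_choose_two]
            have h1 : (n : ℝ) * (n / 2) ≤ n * (n - 1) :=
              mul_le_mul_of_nonneg_left (by linarith) hn0.le
            have h2 := mul_le_mul_of_nonneg_right h1 hq0.le
            linarith
  · refine le_trans ?_ (le_add_of_nonneg_right (by positivity))
    set m := ⌈u⌉₊ with hm
    have hum : u ≤ m := Nat.le_ceil _
    have hm1 : (m : ℝ) ≤ u + 1 := (Nat.ceil_lt_add_one (by linarith)).le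
    have hm2 : (m : ℝ) ≤ 2 * u := by linarith
    have hm0 : 1 ≤ m := Nat.one_le_ceil_iff.2 (by linarith)
    have hmc : ((m + c : ℕ) : ℝ) ≤ 3 * u := by push_cast; linarith
    have hmcn : m + c ≤ n := by
      have : ((m + c : ℕ) : ℝ) ≤ n := by linarith
      exact_mod_cast this
    have hp0pos : 0 < p0 := mul_pos hκ0 hthr
    have hp0le : p0 ≤ thresholdProb n (r + 1) := mul_le_of_le_one_left hthr.le hκ1
    have hpm : p0 * m ≤ 1 := by
      calc p0 * m ≤ thresholdProb n (r + 1) * (2 * u) := by gcongr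
        _ ≤ 1 := by linarith
    have hthrpow := mul_thresholdProb_pow (t := r + 1) (by omega) hn1
    rw [Nat.add_sub_cancel, show r + 1 - 2 = r - 1 by omega, ← hu] at hthrpow
    have hnp : n * p0 ^ r * u ^ (r - 1) = κ ^ r := by
      rw [hp0def, mul_pow]
      calc _ = κ ^ r * (n * thresholdProb n (r + 1) ^ r * u ^ (r - 1)) := by ring
        _ = κ ^ r := by rw [hthrpow, mul_one]
    have hlow : 1 ≤ n * (p0 * m) := by
      have hthr1 : thresholdProb n (r + 1) ≤ 1 := by
        have := le_mul_of_one_le_right hthr.le hu1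
        linarith
      have h1 : thresholdProb n (r + 1) ^ r ≤ thresholdProb n (r + 1) ^ 2 :=
        pow_le_pow_of_le_one hthr.le hthr1 (by omega)
      have hm1' : (1 : ℝ) ≤ m := by exact_mod_cast hm0
      calc (1 : ℝ) = n * thresholdProb n (r + 1) ^ r * u ^ (r - 1) := hthrpow.symm
        _ ≤ n * thresholdProb n (r + 1) ^ 2 * u ^ (r - 1) := by gcongr
        _ = n * thresholdProb n (r + 1) * (thresholdProb n (r + 1) * u ^ (r - 1)) := by ring
        _ ≤ n * thresholdProb n (r + 1) * κ := by gcongr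
        _ = n * (p0 * 1) := by rw [hp0def]; ring
        _ ≤ n * (p0 * m) := by gcongr
    have hcm : c ≤ r * m := by
      have h1 : (c : ℝ) ≤ m := huc.trans hum
      have h2 : c ≤ m := by exact_mod_cast h1
      nlinarith
    calc _ ≤ bprob (allEdges (Fin n)) q (fun ω =>
            (∃ W : Finset (Fin n), W.card = m ∧ r * m - c ≤ (ω ∩ pairsIn W).card) ∨
              ∃ B : Finset (Fin n), B.card = m + c ∧ Disjoint ω (pairsIn Bᶜ)) :=
          bprob_mono hq0.le hq1 fun ω hω h =>
            exists_dense_or_cover (by rwa [Fintype.card_fin]) h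
      _ ≤ _ := bprob_or_le hq0.le hq1 _ _
      _ ≤ Real.exp (-u) + Real.exp (-u) := by
          refine add_le_add ((bprob_exists_dense_le hq0 hq1 hm0 ?_ _).trans ?_)
            ((bprob_exists_cover_le hq0.le hq1 _).trans ?_)
          · exact (mul_le_mul_of_nonneg_right hpn.le (by positivity)).trans hpm
          · rw [Fintype.card_fin]
            exact dense_bound (by omega) hnu (by linarith) hum hm2 hq0 hpn.le hnp hκ hlow hcm
          · rw [Fintype.card_fin]
            exact cover_bound hnu hu1 hmc hmcn hn8 hun hu2 hq1 hdense.le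
      _ = 2 * Real.exp (-u) := by ring

theorem theorem2 (t : ℕ) (ht : 3 ≤ t) :
    (∀ n : ℕ, t ≤ n → wsat (⊤ : SimpleGraph (Fin n)) (starGraphK t) = t.choose 2) ∧
    (∃ c : ℝ, 0 < c ∧ ∀ p : ℕ → unitInterval,
      (fun n : ℕ => 1 / (n : ℝ) ^ 2) =o[atTop] (fun n : ℕ => (p n : ℝ)) →
      (∀ᶠ n : ℕ in atTop, (p n : ℝ) < c * thresholdProb n t) →
      Whp p (fun n G =>
        wsat G (starGraphK t) ≠ wsat (⊤ : SimpleGraph (Fin n)) (starGraphK t))) ∧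
    (∃ C : ℝ, 0 < C ∧ ∀ p : ℕ → unitInterval,
      (∀ᶠ n : ℕ in atTop, C * thresholdProb n t < (p n : ℝ)) →
      Whp p (fun n G =>
        wsat G (starGraphK t) = wsat (⊤ : SimpleGraph (Fin n)) (starGraphK t))) := by
  exact ⟨fun n hn => wsat_top_star (by omega) hn, whp_wsat_star_ne ht, whp_wsat_star_eq ht⟩
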